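/- Let $I=(-1/2,1/2]$ be regarded as a compact group under addition modulo $1$, equipped with Lebesgue measure $\Lambda$, and fix $\Delta>0$. For a finite measure $\nu$ on $I$ let $$\mathbb P_\nu=e^{-\Delta\nu(I)}\sum_{k=0}^\infty\frac{\Delta^k}{k!}\,\nu^{*k},\qquad \nu^{*0}=\delta_0,$$ be the law at time $\Delta$ of the compound Poisson process on $I$ with Lévy measure $\nu$. For absolutely continuous $\nu$ (a density and the measure it defines are denoted by the same symbol) let $p_\nu=d\mathbb P_\nu/d\mathbb P_\Lambda$, and for observations $X_1,\dots,X_n$ let $\ell_n(\nu)=\log\prod_{i=1}^n p_\nu(X_i)$ be the log-likelihood. Let $\nu=e^v$ be a Lévy density on $I$ that is bounded and bounded away from zero. For every $h\in L^2(\nu)$ the finite signed measure $(h\nu-\int_I h\,d\nu\cdot\delta_0)*\mathbb P_\nu$ is absolutely continuous with respect to $\mathbb P_\nu$, so that $$A_\nu(h)=\Delta\,\frac{d\big[(h\nu-\int_I h\,d\nu\cdot\delta_0)*\mathbb P_\nu\big]}{d\mathbb P_\nu}$$ is well defined, and $A_\nu$ is a continuous linear map from $L^2(\nu)$ into $L^2_0(\mathbb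 P_\nu)=\{g\in L^2(\mathbb P_\nu):\int_I g\,d\mathbb P_\nu=0\}$. Moreover, let $h\in L^\infty(I)$, put $\nu_{h,n}=e^{v+h/\sqrt n}$, and let $X_1,X_2,\dots$ be i.i.d. with law $\mathbb P_\nu$. Then $\mathbb P_\nu$ and all $\mathbb P_{\nu_{h,n}}$ are absolutely continuous with respect to $\mathbb P_\Lambda$, the likelihoods $\prod_{i=1}^n p_\nu(X_i)$ and $\prod_{i=1}^n p_{\nu_{h,n}}(X_i)$ are almost surely strictly positive, and, as $n\to\infty$, $$\ell_n(\nu_{h,n})-\ell_n(\nu)=\frac1{\sqrt n}\sum_{i=1}^nA_\nu(h)(X_i)-\frac12\|A_\nu(h)\|^2_{L^2(\mathbb P_\nu)}+o_P(1),$$ where $o_P(1)$ denotes convergence to zero in probability. -/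

import Mathlib

open MeasureTheory ProbabilityTheory Filter Topology
open scoped ENNReal NNReal

namespace CompoundPoisson

/-- The interval `I = (-1/2, 1/2]` viewed as a compact group under addition modulo `1`.
Its `volume` is Lebesgue measure of total mass one, denoted `Λ`. -/
abbrev I : Type := UnitAddCircle

/-- The measure with Lebesgue density `e^v`. -/
noncomputable def levyMeasure (v : I → ℝ) : Measure I :=
  volume.withDensity fun x => ENNReal.ofReal (Real.exp (v x))

/-- The convolution powers of `ν`: `ν^{*0} = δ₀` and `ν^{*(k+1)} = ν^{*k} * ν`. -/
noncomputable def convPow (ν : Measure I) : ℕ → Measure I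
  | 0 => Measure.dirac 0
  | k + 1 => (convPow ν k).conv ν

/-- The law at time `Δ` of the compound Poisson process with finite Lévy measure `ν`:
`P_ν = e^{-Δ ν(I)} ∑_k (Δ^k / k!) ν^{*k}`. -/
noncomputable def law (Δ : ℝ≥0) (ν : Measure I) : Measure I :=
  Measure.sum fun k : ℕ =>
    ENNReal.ofReal (Real.exp (-(Δ * ν.real Set.univ)) * (Δ : ℝ) ^ k / (k.factorial : ℝ)) •
      convPow ν k

/-- The reference measure `P_Λ`, the law whose Lévy measure is Lebesgue measure. -/
noncomputable def refLaw (Δ : ℝ≥0) : Measure I := law Δ volume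

/-- The density `p_ν = dP_ν / dP_Λ`. -/
noncomputable def density (Δ : ℝ≥0) (ν : Measure I) (x : I) : ℝ :=
  ((law Δ ν).rnDeriv (refLaw Δ) x).toReal

/-- The likelihood `L_n(ν) = ∏_{i < n} p_ν(x_i)` of the first `n` observations. -/
noncomputable def likelihood (Δ : ℝ≥0) (ν : Measure I) (n : ℕ) (x : ℕ → I) : ℝ :=
  ∏ i ∈ Finset.range n, density Δ ν (x i)

/-- The log-likelihood `ℓ_n(ν) = log L_n(ν)`. -/
noncomputable def logLikelihood (Δ : ℝ≥0) (ν : Measure I) (n : ℕ) (x : ℕ → I) : ℝ :=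
  Real.log (likelihood Δ ν n x)

/-- Convolution of finite signed measures on `I`: the image under addition of their product. -/
noncomputable def signedConv (κ₁ κ₂ : SignedMeasure I) : SignedMeasure I :=
  (VectorMeasure.prod κ₁ κ₂ (ContinuousLinearMap.mul ℝ ℝ)).map fun p => p.1 + p.2

/-- Any two finite signed measures have a product, so their convolution is well defined. -/
theorem hasProd_signedMeasure (κ₁ κ₂ : SignedMeasure I) :
    VectorMeasure.HasProd κ₁ κ₂ (ContinuousLinearMap.mul ℝ ℝ) := by
  set p₁ := κ₁.toJordanDecomposition.posPart
  set n₁ := κ₁.toJordanDecomposition.negPart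
  set p₂ := κ₂.toJordanDecomposition.posPart
  set n₂ := κ₂.toJordanDecomposition.negPart
  have e₁ : κ₁ = p₁.toSignedMeasure - n₁.toSignedMeasure :=
    κ₁.toSignedMeasure_toJordanDecomposition.symm
  have e₂ : κ₂ = p₂.toSignedMeasure - n₂.toSignedMeasure :=
    κ₂.toSignedMeasure_toJordanDecomposition.symm
  refine ⟨(p₁.prod p₂).toSignedMeasure + (n₁.prod n₂).toSignedMeasure
    - (p₁.prod n₂).toSignedMeasure - (n₁.prod p₂).toSignedMeasure, fun s t hs ht => ?_⟩
  have a₁ : κ₁ s = p₁.real s - n₁.real s := by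
    have h := congrArg (fun κ : SignedMeasure I => κ s) e₁
    simpa [Measure.toSignedMeasure_apply_measurable hs] using h
  have a₂ : κ₂ t = p₂.real t - n₂.real t := by
    have h := congrArg (fun κ : SignedMeasure I => κ t) e₂
    simpa [Measure.toSignedMeasure_apply_measurable ht] using h
  simp only [VectorMeasure.add_apply, VectorMeasure.sub_apply,
    Measure.toSignedMeasure_apply_measurable (hs.prod ht), measureReal_prod_prod,
    ContinuousLinearMap.mul_apply', a₁, a₂]
  ring

theorem convPow_univ (ν : Measure I) [IsFiniteMeasure ν] (k : ℕ) :
    IsFiniteMeasure (convPow ν k) ∧ convPow ν k Set.univ = ν Set.univ ^ k := by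
  induction k with
  | zero => exact ⟨by unfold convPow; infer_instance, by simp [convPow]⟩
  | succ k ih =>
    obtain ⟨h, e⟩ := ih
    refine ⟨by unfold convPow; infer_instance, ?_⟩
    rw [convPow, Measure.conv, Measure.map_apply (by fun_prop) MeasurableSet.univ,
      Set.preimage_univ, Measure.prod_apply MeasurableSet.univ]
    simp [e, pow_succ, mul_comm]

/-- If `ν` is finite then `P_ν` is a probability measure. -/
instance isProbabilityMeasure_law (Δ : ℝ≥0) (ν : Measure I) [IsFiniteMeasure ν] :
    IsProbabilityMeasure (law Δ ν) := by
  refine ⟨?_⟩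
  rw [law, Measure.sum_apply _ MeasurableSet.univ]
  set a : ℝ := ν.real Set.univ with ha
  have ha0 : 0 ≤ a := measureReal_nonneg
  have hν : ν Set.univ = ENNReal.ofReal a := by simp [ha, Measure.real]
  have key : ∀ k : ℕ, (ENNReal.ofReal (Real.exp (-(Δ * a)) * (Δ : ℝ) ^ k / (k.factorial : ℝ)) •
      convPow ν k) Set.univ
        = ENNReal.ofReal (Real.exp (-(Δ * a)) * ((Δ * a) ^ k / (k.factorial : ℝ))) := by
    intro k
    rw [Measure.smul_apply, (convPow_univ ν k).2, hν, smul_eq_mul, ← ENNReal.ofReal_pow ha0,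
      ← ENNReal.ofReal_mul (by positivity)]
    congr 1
    rw [mul_pow]
    ring
  have hs : HasSum (fun k : ℕ => Real.exp (-(Δ * a)) * ((Δ * a) ^ k / (k.factorial : ℝ))) 1 := by
    have h := (NormedSpace.expSeries_div_hasSum_exp (Δ * a : ℝ)).mul_left (Real.exp (-(Δ * a)))
    rwa [← Real.exp_eq_exp_ℝ, ← Real.exp_add, neg_add_cancel, Real.exp_zero] at h
  simp_rw [key]
  rw [← ENNReal.ofReal_tsum_of_nonneg (fun k => by positivity) hs.summable, hs.tsum_eq,
    ENNReal.ofReal_one]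

/-- A density that is bounded above defines a finite measure. -/
theorem isFiniteMeasure_levyMeasure {v : I → ℝ} {C : ℝ} (h : ∀ᵐ x, Real.exp (v x) ≤ C) :
    IsFiniteMeasure (levyMeasure v) := by
  refine ⟨?_⟩
  rw [levyMeasure, withDensity_apply _ MeasurableSet.univ, Measure.restrict_univ]
  calc ∫⁻ x, ENNReal.ofReal (Real.exp (v x)) ≤ ∫⁻ _ : I, ENNReal.ofReal C :=
        lintegral_mono_ae (h.mono fun x hx => ENNReal.ofReal_le_ofReal hx)
    _ < ∞ := by simp

/-- The signed measure `(h ν - ∫ h dν · δ₀) * P_ν`. -/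
noncomputable def scoreMeasure (Δ : ℝ≥0) (ν : Measure I) [IsFiniteMeasure ν] (h : I → ℝ) :
    SignedMeasure I :=
  signedConv (ν.withDensityᵥ h - (∫ x, h x ∂ν) • (Measure.dirac (0 : I)).toSignedMeasure)
    (law Δ ν).toSignedMeasure

/-- The score `A_ν(h) = Δ · d[(h ν - ∫ h dν · δ₀) * P_ν] / dP_ν`. -/
noncomputable def score (Δ : ℝ≥0) (ν : Measure I) [IsFiniteMeasure ν] (h : I → ℝ) (x : I) : ℝ :=
  (Δ : ℝ) * (scoreMeasure Δ ν h).rnDeriv (law Δ ν) x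

/-- `L²₀(P)`: the square integrable functions with `P`-integral zero. -/
noncomputable def L2Zero (P : Measure I) [IsFiniteMeasure P] : Submodule ℝ (Lp ℝ 2 P) where
  carrier := {g | ∫ x, g x ∂P = 0}
  zero_mem' := by
    change ∫ x, (0 : Lp ℝ 2 P) x ∂P = 0
    rw [integral_congr_ae (Lp.coeFn_zero ℝ 2 P)]
    simp
  add_mem' := by
    intro f g hf hg
    change ∫ x, (f + g : Lp ℝ 2 P) x ∂P = 0
    rw [integral_congr_ae (Lp.coeFn_add f g)]
    change ∫ x, (f x + g x) ∂P = 0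
    rw [integral_add ((Lp.memLp f).integrable one_le_two) ((Lp.memLp g).integrable one_le_two),
      show ∫ x, f x ∂P = 0 from hf, show ∫ x, g x ∂P = 0 from hg, add_zero]
  smul_mem' := by
    intro c f hf
    change ∫ x, (c • f : Lp ℝ 2 P) x ∂P = 0
    rw [integral_congr_ae (Lp.coeFn_smul c f)]
    change ∫ x, c • f x ∂P = 0
    rw [integral_smul, show ∫ x, f x ∂P = 0 from hf, smul_zero]

end CompoundPoisson

open CompoundPoisson

namespace CompoundPoisson

/-! Let X be the sum of the jumps up to time Δ and S the sum of h over the same jumps; `jointLaw` is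
the law of (X, S) under the Lévy measure ν. Since e^{tS} is a product over the jumps, weighting by
it tilts every jump: its conditional expectation given X is e^r times the density of the tilted law,
where r = Δ(ν_t(I) - ν(I)) (`lintegral_jointLaw`). So the likelihood ratio is E[e^{tS - r} | X], and
by the Mecke formula the score is E[S - Δ ∫ h dν | X] (`setIntegral_score_eq`).

A Taylor expansion pointwise in S leaves a remainder of order t² (e^{2S} + e^{-2S}). The conditional
expectations of e^{±2S} given X are bounded, being multiples of densities of compound Poisson laws
with respect to P_ν. Such densities are bounded (`law_le_smul_law`): every law is at most δ₀ plus a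
multiple of Λ, while P_ν dominates δ₀ through its no-jump term and Λ through its one-jump term.
Hence R_t = 1 + tA + O(t²) uniformly (`exists_abs_rnDeriv_tilt_sub_le`).

With t = 1/√n, each summand log R_t - tA + t²‖A‖²/2 is O(1/n), and its mean is O(n^{-3/2}) because
R_t integrates to 1 and A to 0. Thus the row sum has variance and squared mean O(1/n), and
Chebyshev's inequality concludes.

The score operator rests on ν * P_ν ≤ K P_ν: it makes f ↦ f(x + y) bounded from L²(P_ν) to L²(ν ⊗
P_ν), and the adjoint of this map sends h(x) to the density of (hν) * P_ν. -/

/-! ### Mutual domination of compound Poisson laws -/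

theorem conv_volume (μ : Measure I) [IsFiniteMeasure μ] :
    μ.conv (volume : Measure I) = μ Set.univ • (volume : Measure I) := by
  ext B hB
  rw [Measure.conv, Measure.map_apply (by fun_prop) hB,
    Measure.prod_apply (measurable_add hB)]
  have : ∀ x : I, volume (Prod.mk x ⁻¹' ((fun p : I × I => p.1 + p.2) ⁻¹' B)) = volume B :=
    fun x => measure_preimage_add volume x B
  simp_rw [this]
  simp [mul_comm]

theorem conv_mono_right (μ : Measure I) [SFinite μ] {ν ν' : Measure I} [SFinite ν] [SFinite ν']
    (h : ν ≤ ν') : μ.conv ν ≤ μ.conv ν' :=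
  Measure.map_mono (Measure.prod_mono le_rfl h) (by fun_prop)

theorem conv_le_smul_volume (μ : Measure I) [IsFiniteMeasure μ] {ν : Measure I} [SFinite ν]
    {C : ℝ≥0} (h : ν ≤ C • (volume : Measure I)) :
    μ.conv ν ≤ (C * μ Set.univ) • (volume : Measure I) := by
  refine (conv_mono_right μ h).trans (le_of_eq ?_)
  have : μ.conv (C • (volume : Measure I)) = (C : ℝ≥0∞) • μ.conv (volume : Measure I) := by
    rw [Measure.conv_comm, Measure.conv_comm μ]
    exact Measure.conv_smul_left (volume : Measure I) μ (C : ℝ≥0∞)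
  rw [this, conv_volume, smul_smul]

/-- The Poisson weights of `law`. -/
noncomputable def weight (Δ : ℝ≥0) (a : ℝ) (k : ℕ) : ℝ :=
  Real.exp (-(Δ * a)) * (Δ : ℝ) ^ k / (k.factorial : ℝ)

theorem weight_nonneg (Δ : ℝ≥0) (a : ℝ) (k : ℕ) : 0 ≤ weight Δ a k := by
  unfold weight; positivity

/-- This index shift drives the Mecke formula: a factor counting the jumps is traded for one jump
fewer and a factor Δ. The powers of a are absent from the weights because they sit in the mass of
`convPow`. -/
theorem weight_succ_mul (Δ : ℝ≥0) (a : ℝ) (k : ℕ) :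
    weight Δ a (k + 1) * (k + 1 : ℕ) = Δ * weight Δ a k := by
  unfold weight
  rw [Nat.factorial_succ]
  push_cast
  have : (k.factorial : ℝ) ≠ 0 := by positivity
  have : (k + 1 : ℝ) ≠ 0 := by positivity
  field_simp
  ring

theorem weight_succ_le (Δ : ℝ≥0) (a : ℝ) (k : ℕ) : weight Δ a (k + 1) ≤ Δ * weight Δ a k := by
  rw [← weight_succ_mul]
  refine le_mul_of_one_le_right (weight_nonneg ..) ?_
  simp

theorem law_eq (Δ : ℝ≥0) (ν : Measure I) :
    law Δ ν = Measure.sum fun k : ℕ =>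
      ENNReal.ofReal (weight Δ (ν.real Set.univ) k) • convPow ν k := rfl

/-- Only the no-jump term can carry an atom. Every later power has a factor ν ≤ C Λ, so by
translation invariance it is at most C Λ times the mass of the preceding power; the weights shift at
the cost of Δ, and what remains to be summed is the total mass 1. -/
theorem law_le_add (Δ : ℝ≥0) {ν : Measure I} [IsFiniteMeasure ν] {C : ℝ≥0}
    (h : ν ≤ C • (volume : Measure I)) :
    law Δ ν ≤ Measure.dirac 0 + (Δ * C) • (volume : Measure I) := by
  refine Measure.le_iff.2 fun B hB => ?_
  have hfin : ∀ k, IsFiniteMeasure (convPow ν k) := fun k => (convPow_univ ν k).1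
  have htot : ∑' k, ENNReal.ofReal (weight Δ (ν.real Set.univ) k) * convPow ν k Set.univ = 1 := by
    have := measure_univ (μ := law Δ ν)
    rw [law_eq, Measure.sum_apply _ MeasurableSet.univ] at this
    simpa using this
  rw [law_eq, Measure.sum_apply _ hB, tsum_eq_zero_add' ENNReal.summable]
  simp only [Measure.smul_apply, smul_eq_mul, Measure.add_apply]
  refine add_le_add ?_ ?_
  · refine mul_le_of_le_one_left' ?_
    rw [ENNReal.ofReal_le_one, weight]
    simp only [pow_zero, Nat.factorial_zero, mul_one, Nat.cast_one, div_one, Real.exp_le_one_iff,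
      neg_nonpos]
    positivity
  · calc ∑' k, ENNReal.ofReal (weight Δ (ν.real Set.univ) (k + 1)) * convPow ν (k + 1) B
        ≤ ∑' k, (ENNReal.ofReal (weight Δ (ν.real Set.univ) k) * convPow ν k Set.univ) *
            (Δ * C * volume B) := by
          refine ENNReal.tsum_le_tsum fun k => ?_
          have h1 := Measure.le_iff.1 (conv_le_smul_volume (convPow ν k) h) B hB
          have h2 : ENNReal.ofReal (weight Δ (ν.real Set.univ) (k + 1)) ≤
              Δ * ENNReal.ofReal (weight Δ (ν.real Set.univ) k) := by
            rw [← ENNReal.ofReal_coe_nnreal, ← ENNReal.ofReal_mul (by positivity)]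
            exact ENNReal.ofReal_le_ofReal (weight_succ_le ..)
          refine (mul_le_mul' h2 h1).trans (le_of_eq ?_)
          simp only [Measure.smul_apply, smul_eq_mul]
          ring
      _ = Δ * C * volume B := by rw [ENNReal.tsum_mul_right, htot, one_mul]
      _ = _ := by simp [ENNReal.smul_def]

theorem convPow_one (ν : Measure I) [SFinite ν] : convPow ν 1 = ν := by
  simp [convPow]

theorem smul_convPow_le_law (Δ : ℝ≥0) (ν : Measure I) (k : ℕ) :
    ENNReal.ofReal (weight Δ (ν.real Set.univ) k) • convPow ν k ≤ law Δ ν := by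
  rw [law_eq]
  exact Measure.le_sum
    (fun k : ℕ => ENNReal.ofReal (weight Δ (ν.real Set.univ) k) • convPow ν k) k

theorem weight_pos {Δ : ℝ≥0} (hΔ : 0 < Δ) (a : ℝ) (k : ℕ) : 0 < weight Δ a k := by
  have : (0 : ℝ) < Δ := hΔ
  unfold weight; positivity

theorem smul_measure_mono {α : Type*} [MeasurableSpace α] {μ ν : Measure α} (K : ℝ≥0)
    (h : μ ≤ ν) : K • μ ≤ K • ν := by
  refine Measure.le_iff.2 fun B hB => ?_
  simp only [Measure.smul_apply, ENNReal.smul_def, smul_eq_mul]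
  exact mul_le_mul' le_rfl (Measure.le_iff.1 h B hB)

theorem le_smul_of_smul_le {α : Type*} [MeasurableSpace α] {μ ν : Measure α} {c : ℝ} (hc : 0 < c)
    (h : ENNReal.ofReal c • μ ≤ ν) : μ ≤ (Real.toNNReal c⁻¹) • ν := by
  refine Measure.le_iff.2 fun B hB => ?_
  have h1 := Measure.le_iff.1 h B hB
  simp only [Measure.smul_apply, smul_eq_mul, ENNReal.smul_def] at h1 ⊢
  calc μ B = ENNReal.ofReal c⁻¹ * (ENNReal.ofReal c * μ B) := by
        rw [← mul_assoc, ← ENNReal.ofReal_mul (by positivity), inv_mul_cancel₀ hc.ne']; simp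
    _ ≤ _ := mul_le_mul' le_rfl h1

theorem dirac_le_smul_law {Δ : ℝ≥0} (hΔ : 0 < Δ) (ν : Measure I) :
    ∃ K : ℝ≥0, Measure.dirac 0 ≤ K • law Δ ν :=
  ⟨_, le_smul_of_smul_le (weight_pos hΔ _ 0) (smul_convPow_le_law Δ ν 0)⟩

/-- The one-jump term suffices, being a positive multiple of ν. -/
theorem volume_le_smul_law {Δ : ℝ≥0} (hΔ : 0 < Δ) {ν : Measure I} [SFinite ν] {c : ℝ} (hc : 0 < c)
    (h : ENNReal.ofReal c • (volume : Measure I) ≤ ν) :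
    ∃ K : ℝ≥0, (volume : Measure I) ≤ K • law Δ ν := by
  have h1 := smul_convPow_le_law Δ ν 1
  rw [convPow_one] at h1
  have h2 := le_smul_of_smul_le (weight_pos hΔ _ 1) h1
  refine ⟨_, (le_smul_of_smul_le hc h).trans ((smul_measure_mono _ h2).trans
    (le_of_eq (smul_smul _ _ _)))⟩

/-- Compound Poisson laws are dominated by one another as soon as the Lévy densities are bounded
above, respectively bounded away from zero. -/
theorem law_le_smul_law {Δ : ℝ≥0} (hΔ : 0 < Δ) {ν ν' : Measure I} [SFinite ν] [IsFiniteMeasure ν']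
    {c : ℝ} (hc : 0 < c) (h : ENNReal.ofReal c • (volume : Measure I) ≤ ν) {C : ℝ≥0}
    (h' : ν' ≤ C • (volume : Measure I)) : ∃ K : ℝ≥0, law Δ ν' ≤ K • law Δ ν := by
  obtain ⟨K₁, h₁⟩ := dirac_le_smul_law hΔ ν
  obtain ⟨K₂, h₂⟩ := volume_le_smul_law hΔ hc h
  refine ⟨K₁ + Δ * C * K₂, (law_le_add Δ h').trans ?_⟩
  rw [add_smul, mul_smul (Δ * C)]
  exact add_le_add h₁ (smul_measure_mono _ h₂)

/-- This gives both the absolute continuity of the score measure and the boundedness on L² of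
composition with addition. -/
theorem conv_le_smul_law {Δ : ℝ≥0} (hΔ : 0 < Δ) {ν : Measure I} [IsFiniteMeasure ν]
    {c : ℝ} (hc : 0 < c) (h : ENNReal.ofReal c • (volume : Measure I) ≤ ν) {C : ℝ≥0}
    (h' : ν ≤ C • (volume : Measure I)) : ∃ K : ℝ≥0, ν.conv (law Δ ν) ≤ K • law Δ ν := by
  obtain ⟨K, hK⟩ := volume_le_smul_law hΔ hc h
  refine ⟨C * K, ?_⟩
  rw [Measure.conv_comm, mul_smul]
  have h1 := conv_le_smul_volume (law Δ ν) h'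
  rw [measure_univ, mul_one] at h1
  exact h1.trans (smul_measure_mono C hK)

/-! ### Joint law of the process and an additive functional; exponential tilting -/

/-- The image of the product measure `ν^{⊗k}` under `(x₁, …, x_k) ↦ (∑ x_i, ∑ h x_i)`. -/
noncomputable def jointPow (ν : Measure I) (h : I → ℝ) : ℕ → Measure (I × ℝ)
  | 0 => Measure.dirac 0
  | k + 1 => ((jointPow ν h k).prod ν).map fun q => (q.1.1 + q.2, q.1.2 + h q.2)

/-- The joint law of the compound Poisson variable `∑ x_i` and of `∑ h x_i`, the sums being over
the jumps up to time `Δ`. -/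
noncomputable def jointLaw (Δ : ℝ≥0) (ν : Measure I) (h : I → ℝ) : Measure (I × ℝ) :=
  Measure.sum fun k : ℕ => ENNReal.ofReal (weight Δ (ν.real Set.univ) k) • jointPow ν h k

/-- The exponential tilting of `ν` by `t h`. -/
noncomputable def tilt (ν : Measure I) (h : I → ℝ) (t : ℝ) : Measure I :=
  ν.withDensity fun x => ENNReal.ofReal (Real.exp (t * h x))

theorem tilt_zero (ν : Measure I) (h : I → ℝ) : tilt ν h 0 = ν := by
  simp [tilt]

theorem tilt_le (ν : Measure I) {h : I → ℝ} {b : ℝ} (hb : ∀ x, |h x| ≤ b) (t : ℝ) :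
    tilt ν h t ≤ (Real.toNNReal (Real.exp (|t| * b))) • ν := by
  refine Measure.le_iff.2 fun B hB => ?_
  rw [tilt, withDensity_apply _ hB, Measure.smul_apply, ENNReal.smul_def, smul_eq_mul]
  calc ∫⁻ x in B, ENNReal.ofReal (Real.exp (t * h x)) ∂ν
      ≤ ∫⁻ _ in B, ENNReal.ofReal (Real.exp (|t| * b)) ∂ν := by
        refine lintegral_mono fun x => ENNReal.ofReal_le_ofReal (Real.exp_le_exp.2 ?_)
        calc t * h x ≤ |t * h x| := le_abs_self _
          _ = |t| * |h x| := abs_mul _ _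
          _ ≤ _ := mul_le_mul_of_nonneg_left (hb x) (abs_nonneg t)
    _ = _ := by simp [ENNReal.ofReal]

instance isFiniteMeasure_jointPow (ν : Measure I) [IsFiniteMeasure ν] (h : I → ℝ) (k : ℕ) :
    IsFiniteMeasure (jointPow ν h k) := by
  induction k with
  | zero => unfold jointPow; infer_instance
  | succ k ih => unfold jointPow; infer_instance

section

variable {ν : Measure I} [IsFiniteMeasure ν] {h : I → ℝ}

theorem isFiniteMeasure_tilt {b : ℝ} (hb : ∀ x, |h x| ≤ b) (t : ℝ) :
    IsFiniteMeasure (tilt ν h t) :=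
  isFiniteMeasure_of_le _ (tilt_le ν hb t)

/-- The exponential of a sum over jumps factorises, and each factor tilts one copy of ν. The
induction needs all φ at once, since integrating out the last jump replaces φ by an average of its
translates. -/
theorem lintegral_jointPow (hh : Measurable h) {t : ℝ} [IsFiniteMeasure (tilt ν h t)] (k : ℕ)
    {φ : I → ℝ≥0∞} (hφ : Measurable φ) :
    ∫⁻ p, φ p.1 * ENNReal.ofReal (Real.exp (t * p.2)) ∂(jointPow ν h k)
      = ∫⁻ x, φ x ∂(convPow (tilt ν h t) k) := by
  induction k generalizing φ with
  | zero =>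
    rw [jointPow, convPow, lintegral_dirac' _ (by fun_prop), lintegral_dirac' _ hφ]
    simp
  | succ k ih =>
    have : IsFiniteMeasure (convPow (tilt ν h t) k) := (convPow_univ _ k).1
    have hF : Measurable fun q : I × I =>
        φ (q.1 + q.2) * ENNReal.ofReal (Real.exp (t * h q.2)) := by fun_prop
    rw [jointPow, convPow, lintegral_map (by fun_prop) (by fun_prop), Measure.lintegral_conv hφ,
      lintegral_prod _ (by fun_prop)]
    calc ∫⁻ p : I × ℝ, ∫⁻ y, φ (p.1 + y) * ENNReal.ofReal (Real.exp (t * (p.2 + h y))) ∂ν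
          ∂(jointPow ν h k)
        = ∫⁻ p : I × ℝ, (∫⁻ y, φ (p.1 + y) * ENNReal.ofReal (Real.exp (t * h y)) ∂ν) *
            ENNReal.ofReal (Real.exp (t * p.2)) ∂(jointPow ν h k) := by
          refine lintegral_congr fun p => ?_
          rw [← lintegral_mul_const _ (by fun_prop)]
          refine lintegral_congr fun y => ?_
          rw [mul_add, Real.exp_add, ENNReal.ofReal_mul (Real.exp_nonneg _)]
          ring
      _ = ∫⁻ x, ∫⁻ y, φ (x + y) * ENNReal.ofReal (Real.exp (t * h y)) ∂ν
            ∂(convPow (tilt ν h t) k) :=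
          ih hF.lintegral_prod_right'
      _ = _ := by
          refine lintegral_congr fun x => ?_
          rw [tilt, lintegral_withDensity_eq_lintegral_mul _ (by fun_prop) (by fun_prop)]
          simp [mul_comm]

/-- The two series agree term by term except for the normalisations e^{-Δν(I)} and e^{-Δν_t(I)},
whose quotient is the prefactor. -/
theorem lintegral_jointLaw (hh : Measurable h) (Δ : ℝ≥0) {t : ℝ} [IsFiniteMeasure (tilt ν h t)]
    {φ : I → ℝ≥0∞} (hφ : Measurable φ) :
    ∫⁻ p, φ p.1 * ENNReal.ofReal (Real.exp (t * p.2)) ∂(jointLaw Δ ν h)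
      = ENNReal.ofReal (Real.exp (Δ * ((tilt ν h t).real Set.univ - ν.real Set.univ))) *
        ∫⁻ x, φ x ∂(law Δ (tilt ν h t)) := by
  rw [jointLaw, lintegral_sum_measure, law_eq, lintegral_sum_measure, ← ENNReal.tsum_mul_left]
  congr with k
  rw [lintegral_smul_measure, lintegral_smul_measure, lintegral_jointPow hh k hφ, smul_eq_mul,
    smul_eq_mul, ← mul_assoc, ← ENNReal.ofReal_mul (Real.exp_nonneg _)]
  congr 2
  rw [weight, weight, mul_sub, sub_eq_add_neg, Real.exp_add, Real.exp_neg (Δ * (tilt ν h t).real _)]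
  field_simp

theorem lintegral_jointLaw_fst (hh : Measurable h) (Δ : ℝ≥0) {φ : I → ℝ≥0∞} (hφ : Measurable φ) :
    ∫⁻ p, φ p.1 ∂(jointLaw Δ ν h) = ∫⁻ x, φ x ∂(law Δ ν) := by
  have : IsFiniteMeasure (tilt ν h 0) := by rw [tilt_zero]; infer_instance
  simpa [tilt_zero] using lintegral_jointLaw hh Δ (t := 0) hφ

theorem map_fst_jointLaw (hh : Measurable h) (Δ : ℝ≥0) :
    (jointLaw Δ ν h).map Prod.fst = law Δ ν := by
  ext B hB
  rw [← lintegral_indicator_one hB, ← lintegral_indicator_one hB,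
    lintegral_map (measurable_one.indicator hB) measurable_fst]
  exact lintegral_jointLaw_fst hh Δ (measurable_one.indicator hB)

theorem isProbabilityMeasure_jointLaw (hh : Measurable h) (Δ : ℝ≥0) :
    IsProbabilityMeasure (jointLaw Δ ν h) := by
  refine ⟨?_⟩
  rw [← Set.preimage_univ (f := Prod.fst), ← Measure.map_apply measurable_fst MeasurableSet.univ,
    map_fst_jointLaw hh, measure_univ]

end

/-! ### The score as a Radon–Nikodym density -/

/-- A product of signed measures is determined by its values on rectangles, which identifies it with
a density times ν ⊗ P_ν minus a multiple of δ₀ ⊗ P_ν; the latter is pushed by addition to P_ν. -/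
theorem scoreMeasure_apply (Δ : ℝ≥0) {ν : Measure I} [IsFiniteMeasure ν] {h : I → ℝ}
    (hh : Integrable h ν) {B : Set I} (hB : MeasurableSet B) :
    scoreMeasure Δ ν h B = (∫ p in (fun p : I × I => p.1 + p.2) ⁻¹' B, h p.1 ∂(ν.prod (law Δ ν)))
      - (∫ x, h x ∂ν) * (law Δ ν).real B := by
  have hi : Integrable (fun p : I × I => h p.1) (ν.prod (law Δ ν)) := hh.comp_fst _
  have key : VectorMeasure.prod
      (ν.withDensityᵥ h - (∫ x, h x ∂ν) • (Measure.dirac (0 : I)).toSignedMeasure)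
      (law Δ ν).toSignedMeasure (ContinuousLinearMap.mul ℝ ℝ)
      = (ν.prod (law Δ ν)).withDensityᵥ (fun p : I × I => h p.1)
        - (∫ x, h x ∂ν) • ((Measure.dirac (0 : I)).prod (law Δ ν)).toSignedMeasure := by
    refine VectorMeasure.prod_eq_of_forall_apply_prod fun s t hs ht => ?_
    simp only [sub_apply, smul_apply, withDensityᵥ_apply hi (hs.prod ht),
      withDensityᵥ_apply hh hs, Measure.toSignedMeasure_apply_measurable hs,
      Measure.toSignedMeasure_apply_measurable ht,
      Measure.toSignedMeasure_apply_measurable (hs.prod ht), measureReal_prod_prod,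
      ContinuousLinearMap.mul_apply', smul_eq_mul]
    have : ∫ p in s ×ˢ t, h p.1 ∂(ν.prod (law Δ ν)) = (∫ x in s, h x ∂ν) * (law Δ ν).real t := by
      have := setIntegral_prod_mul (μ := ν) (ν := law Δ ν) h (fun _ => (1 : ℝ)) s t
      simpa using this
    rw [this]
    ring
  have hT : Measurable fun p : I × I => p.1 + p.2 := by fun_prop
  have hz : ((Measure.dirac (0 : I)).prod (law Δ ν)).real ((fun p : I × I => p.1 + p.2) ⁻¹' B)
      = (law Δ ν).real B := by
    rw [← map_measureReal_apply hT hB]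
    change ((Measure.dirac (0 : I)).conv (law Δ ν)).real B = _
    rw [Measure.dirac_zero_conv]
  rw [scoreMeasure, signedConv, key, VectorMeasure.map_apply _ hT hB]
  simp only [sub_apply, smul_apply, withDensityᵥ_apply hi (hT hB),
    Measure.toSignedMeasure_apply_measurable (hT hB), hz, smul_eq_mul]

theorem scoreMeasure_absolutelyContinuous (Δ : ℝ≥0) {ν : Measure I} [IsFiniteMeasure ν]
    (hν : ν.conv (law Δ ν) ≪ law Δ ν) {h : I → ℝ} (hh : Integrable h ν) :
    scoreMeasure Δ ν h ≪ᵥ (law Δ ν).toENNRealVectorMeasure := by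
  refine VectorMeasure.AbsolutelyContinuous.mk fun B hB h0 => ?_
  rw [Measure.toENNRealVectorMeasure_apply_measurable hB] at h0
  rw [scoreMeasure_apply Δ hh hB, setIntegral_measure_zero, measureReal_def, h0]
  · simp
  · rw [← Measure.map_apply (by fun_prop) hB]
    exact hν h0

theorem measurable_score (Δ : ℝ≥0) (ν : Measure I) [IsFiniteMeasure ν] (h : I → ℝ) :
    Measurable (score Δ ν h) :=
  (SignedMeasure.measurable_rnDeriv _ _).const_mul _

theorem integrable_score (Δ : ℝ≥0) (ν : Measure I) [IsFiniteMeasure ν] (h : I → ℝ) :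
    Integrable (score Δ ν h) (law Δ ν) :=
  (SignedMeasure.integrable_rnDeriv _ _).const_mul _

/-- Absolute continuity excludes a singular part, so these integrals characterise the score almost
everywhere; later arguments use it only through them. -/
theorem setIntegral_score (Δ : ℝ≥0) {ν : Measure I} [IsFiniteMeasure ν]
    (hν : ν.conv (law Δ ν) ≪ law Δ ν) {h : I → ℝ} (hh : Integrable h ν) {B : Set I}
    (hB : MeasurableSet B) :
    ∫ x in B, score Δ ν h x ∂(law Δ ν) =
      Δ * ((∫ p in (fun p : I × I => p.1 + p.2) ⁻¹' B, h p.1 ∂(ν.prod (law Δ ν)))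
        - (∫ x, h x ∂ν) * (law Δ ν).real B) := by
  rw [← scoreMeasure_apply Δ hh hB]
  simp only [score]
  rw [integral_const_mul, ← withDensityᵥ_apply (SignedMeasure.integrable_rnDeriv _ _) hB,
    SignedMeasure.withDensityᵥ_rnDeriv_eq _ _ (scoreMeasure_absolutelyContinuous Δ hν hh)]

theorem integral_score (Δ : ℝ≥0) {ν : Measure I} [IsFiniteMeasure ν]
    (hν : ν.conv (law Δ ν) ≪ law Δ ν) {h : I → ℝ} (hh : Integrable h ν) :
    ∫ x, score Δ ν h x ∂(law Δ ν) = 0 := by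
  rw [← setIntegral_univ, setIntegral_score Δ hν hh MeasurableSet.univ, Set.preimage_univ,
    setIntegral_univ]
  have := integral_prod_mul (μ := ν) (ν := law Δ ν) h (fun _ => (1 : ℝ))
  simp only [mul_one, integral_const, smul_eq_mul, probReal_univ] at this
  simp [this]

theorem score_congr (Δ : ℝ≥0) {ν : Measure I} [IsFiniteMeasure ν] {h h' : I → ℝ}
    (hh : h =ᵐ[ν] h') : score Δ ν h = score Δ ν h' := by
  ext x
  simp only [score, scoreMeasure]
  rw [WithDensityᵥEq.congr_ae hh, integral_congr_ae hh]

/-! ### The score operator on L² -/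

section

variable {α β : Type*} [MeasurableSpace α] [MeasurableSpace β] {μ : Measure α} {ρ : Measure β}
  {T : α → β} {K : ℝ≥0}

theorem memLp_comp_of_map_le (hT : Measurable T) (hK : μ.map T ≤ K • ρ) {f : β → ℝ}
    (hf : MemLp f 2 ρ) : MemLp (f ∘ T) 2 μ :=
  (hf.of_measure_le_smul (c := (K : ℝ≥0∞)) ENNReal.coe_ne_top hK).comp_of_map hT.aemeasurable

theorem quasiMeasurePreserving_of_map_le (hT : Measurable T) (hK : μ.map T ≤ K • ρ) :
    Measure.QuasiMeasurePreserving T μ ρ :=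
  ⟨hT, (Measure.absolutelyContinuous_of_le hK).trans (Measure.smul_absolutelyContinuous)⟩

/-- Composition with `T`, as a bounded operator between `L²` spaces. -/
noncomputable def compL2 (hT : Measurable T) (hK : μ.map T ≤ K • ρ) :
    Lp ℝ 2 ρ →L[ℝ] Lp ℝ 2 μ :=
  LinearMap.mkContinuous
    { toFun := fun f => (memLp_comp_of_map_le hT hK (Lp.memLp f)).toLp (f ∘ T)
      map_add' := fun f g => by
        rw [← MemLp.toLp_add]
        exact MemLp.toLp_congr _ _
          ((quasiMeasurePreserving_of_map_le hT hK).ae_eq_comp (Lp.coeFn_add f g))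
      map_smul' := fun c f => by
        rw [RingHom.id_apply, ← MemLp.toLp_const_smul]
        exact MemLp.toLp_congr _ _
          ((quasiMeasurePreserving_of_map_le hT hK).ae_eq_comp (Lp.coeFn_smul c f)) }
    -- The operator bound is √K, the factor by which the L² norm grows when ρ is replaced by K ρ.
    (((K : ℝ≥0∞) ^ (1 / (2 : ℝ≥0∞)).toReal).toReal) fun f => by
      simp only [LinearMap.coe_mk, AddHom.coe_mk, Lp.norm_toLp]
      rw [Lp.norm_def, ← ENNReal.toReal_mul]
      refine ENNReal.toReal_mono (ENNReal.mul_ne_top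
        (ENNReal.rpow_ne_top_of_nonneg (by simp) ENNReal.coe_ne_top) (Lp.eLpNorm_ne_top f)) ?_
      have hf : AEStronglyMeasurable f (μ.map T) :=
        ((Lp.memLp f).of_measure_le_smul (c := (K : ℝ≥0∞)) ENNReal.coe_ne_top hK).1
      rw [← eLpNorm_map_measure hf hT.aemeasurable]
      refine (eLpNorm_mono_measure f hK).trans (le_of_eq ?_)
      change eLpNorm f 2 ((K : ℝ≥0∞) • ρ) = _
      rw [eLpNorm_smul_measure_of_ne_top (p := 2) ENNReal.ofNat_ne_top, smul_eq_mul]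

theorem coeFn_compL2 (hT : Measurable T) (hK : μ.map T ≤ K • ρ) (f : Lp ℝ 2 ρ) :
    compL2 hT hK f =ᵐ[μ] f ∘ T :=
  (memLp_comp_of_map_le hT hK (Lp.memLp f)).coeFn_toLp

theorem compL2_indicatorConstLp [IsFiniteMeasure μ] [IsFiniteMeasure ρ] (hT : Measurable T)
    (hK : μ.map T ≤ K • ρ) {B : Set β} (hB : MeasurableSet B) :
    compL2 hT hK (indicatorConstLp 2 hB (measure_ne_top ρ B) (1 : ℝ)) =
      indicatorConstLp 2 (hT hB) (measure_ne_top μ _) (1 : ℝ) := by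
  refine Lp.ext ((coeFn_compL2 hT hK _).trans ?_)
  refine ((quasiMeasurePreserving_of_map_le hT hK).ae_eq_comp indicatorConstLp_coeFn).trans ?_
  exact indicatorConstLp_coeFn.symm

end

theorem map_fst_prod_law (Δ : ℝ≥0) (ν : Measure I) [IsFiniteMeasure ν] :
    (ν.prod (law Δ ν)).map Prod.fst ≤ (1 : ℝ≥0) • ν := by
  rw [Measure.map_fst_prod, measure_univ]
  simp

/-- The score operator from `L²(ν)` to `L²(P_ν)`. -/
noncomputable def scoreL2 (Δ : ℝ≥0) (ν : Measure I) [IsFiniteMeasure ν] {K : ℝ≥0}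
    (hK : ν.conv (law Δ ν) ≤ K • law Δ ν) : Lp ℝ 2 ν →L[ℝ] Lp ℝ 2 (law Δ ν) :=
  -- The adjoint of f ↦ f(x + y) averages over the fibres of addition, so applied to h(x) it yields
  -- the density of (hν) * P_ν. The rank-one term subtracts the constant ∫ h dν.
  (Δ : ℝ) • ((ContinuousLinearMap.adjoint
      (compL2 (T := fun p : I × I => p.1 + p.2) (by fun_prop) hK)).comp
        (compL2 measurable_fst (map_fst_prod_law Δ ν))
    - ContinuousLinearMap.smulRight
      (innerSL ℝ (indicatorConstLp 2 MeasurableSet.univ (measure_ne_top ν Set.univ) (1 : ℝ)))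
      (indicatorConstLp 2 MeasurableSet.univ (measure_ne_top (law Δ ν) Set.univ) (1 : ℝ)))

theorem setIntegral_scoreL2 (Δ : ℝ≥0) {ν : Measure I} [IsFiniteMeasure ν] {K : ℝ≥0}
    (hK : ν.conv (law Δ ν) ≤ K • law Δ ν) (h : Lp ℝ 2 ν) {B : Set I} (hB : MeasurableSet B) :
    ∫ x in B, scoreL2 Δ ν hK h x ∂(law Δ ν) =
      Δ * ((∫ p in (fun p : I × I => p.1 + p.2) ⁻¹' B, h p.1 ∂(ν.prod (law Δ ν)))
        - (∫ x, h x ∂ν) * (law Δ ν).real B) := by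
  have hT : Measurable fun p : I × I => p.1 + p.2 := by fun_prop
  rw [← L2.inner_indicatorConstLp_one (𝕜 := ℝ) hB (measure_ne_top _ _)]
  simp only [scoreL2, smul_apply, sub_apply, ContinuousLinearMap.comp_apply,
    ContinuousLinearMap.smulRight_apply, innerSL_apply_apply]
  rw [inner_smul_right, inner_sub_right, inner_smul_right, ContinuousLinearMap.adjoint_inner_right,
    compL2_indicatorConstLp hT hK hB, L2.inner_indicatorConstLp_one,
    L2.inner_indicatorConstLp_one, L2.inner_indicatorConstLp_one, Measure.restrict_univ]
  congr 2
  · exact setIntegral_congr_ae (hT hB)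
      ((coeFn_compL2 measurable_fst (map_fst_prod_law Δ ν) h).mono fun p hp _ => hp)
  · congr 1
    rw [setIntegral_congr_ae (g := fun _ => (1 : ℝ)) hB]
    · simp
    · filter_upwards [indicatorConstLp_coeFn (p := 2) (hs := MeasurableSet.univ)
        (hμs := measure_ne_top (law Δ ν) Set.univ) (c := (1 : ℝ))] with x hx _
      rw [hx, Set.indicator_univ]

theorem coeFn_scoreL2 (Δ : ℝ≥0) {ν : Measure I} [IsFiniteMeasure ν] {K : ℝ≥0}
    (hK : ν.conv (law Δ ν) ≤ K • law Δ ν) (h : Lp ℝ 2 ν) :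
    scoreL2 Δ ν hK h =ᵐ[law Δ ν] score Δ ν h := by
  have hac : ν.conv (law Δ ν) ≪ law Δ ν :=
    (Measure.absolutelyContinuous_of_le hK).trans Measure.smul_absolutelyContinuous
  have hh : Integrable h ν := (Lp.memLp h).integrable one_le_two
  refine Integrable.ae_eq_of_forall_setIntegral_eq _ _ ((Lp.memLp _).integrable one_le_two)
    (integrable_score Δ ν h) fun B hB _ => ?_
  rw [setIntegral_scoreL2 Δ hK h hB, setIntegral_score Δ hac hh hB]

theorem exists_score_operator (Δ : ℝ≥0) {ν : Measure I} [IsFiniteMeasure ν] {K : ℝ≥0}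
    (hK : ν.conv (law Δ ν) ≤ K • law Δ ν) :
    ∃ A : Lp ℝ 2 ν →L[ℝ] L2Zero (law Δ ν), ∀ h : Lp ℝ 2 ν,
      ((A h : Lp ℝ 2 (law Δ ν)) : I → ℝ) =ᵐ[law Δ ν] score Δ ν h := by
  have hac : ν.conv (law Δ ν) ≪ law Δ ν :=
    (Measure.absolutelyContinuous_of_le hK).trans Measure.smul_absolutelyContinuous
  refine ⟨(scoreL2 Δ ν hK).codRestrict _ fun h => ?_, fun h => coeFn_scoreL2 Δ hK h⟩
  change ∫ x, scoreL2 Δ ν hK h x ∂(law Δ ν) = 0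
  rw [integral_congr_ae (coeFn_scoreL2 Δ hK h)]
  exact integral_score Δ hac ((Lp.memLp h).integrable one_le_two)

/-! ### Elementary exponential inequalities -/

theorem abs_le_exp_add_exp_neg (s : ℝ) : |s| ≤ Real.exp s + Real.exp (-s) := by
  have h1 := Real.add_one_le_exp s
  have h2 := Real.add_one_le_exp (-s)
  have h3 := Real.exp_pos s
  have h4 := Real.exp_pos (-s)
  exact abs_le.2 ⟨by linarith, by linarith⟩

theorem exp_two_mul_abs_le (s : ℝ) : Real.exp (2 * |s|) ≤ Real.exp (2 * s) + Real.exp (-2 * s) := by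
  have h3 := Real.exp_pos (2 * s)
  have h4 := Real.exp_pos (-2 * s)
  rcases abs_cases s with ⟨h, _⟩ | ⟨h, _⟩ <;> rw [h]
  · linarith
  · rw [mul_neg, ← neg_mul]; linarith

theorem abs_exp_sub_one_sub_le (x : ℝ) : |Real.exp x - 1 - x| ≤ x ^ 2 * Real.exp |x| := by
  have h := Complex.norm_exp_sub_sum_le_norm_mul_exp (x : ℂ) 2
  simp only [Finset.sum_range_succ, Finset.range_zero, Finset.sum_empty, pow_zero,
    Nat.factorial_zero, Nat.cast_one, div_one, zero_add, pow_one, Nat.factorial_one,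
    Complex.norm_real, Real.norm_eq_abs, sq_abs] at h
  have e : Complex.exp x - (1 + x) = ((Real.exp x - 1 - x : ℝ) : ℂ) := by
    push_cast; ring
  rwa [e, Complex.norm_real, Real.norm_eq_abs] at h

theorem sq_le_two_mul_exp {u : ℝ} (hu : 0 ≤ u) : u ^ 2 ≤ 2 * Real.exp u := by
  have := Real.quadratic_le_exp_of_nonneg hu
  linarith

/-- Second order remainder of the exponential tilt, with normalising exponent `r ≈ t q`. -/
theorem abs_exp_tilt_sub_le {t s r q κ κ' : ℝ} (ht : |t| ≤ 1) (hκ : 0 ≤ κ) (hκ' : 0 ≤ κ')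
    (hr : |r| ≤ |t| * κ) (hr' : |r - t * q| ≤ t ^ 2 * κ') :
    |Real.exp (t * s - r) - 1 - t * (s - q)| ≤
      t ^ 2 * ((2 * Real.exp (2 * κ) + κ') * (Real.exp (2 * s) + Real.exp (-2 * s))) := by
  -- The exponent is at most |t| u in modulus, so the Taylor remainder is at most t² u² e^u.
  -- Bounding u² by 2 e^u leaves 2 e^{2u} = 2 e^{2κ} e^{2|s|}, which explains the exponents ±2; the
  -- error κ' is absorbed using 1 ≤ e^{2|s|}.
  set u := |s| + κ with hu
  have hu0 : 0 ≤ u := by positivity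
  have hx : |t * s - r| ≤ |t| * u := by
    calc |t * s - r| ≤ |t * s| + |r| := abs_sub _ _
      _ ≤ |t| * |s| + |t| * κ := by rw [abs_mul]; linarith
      _ = _ := by rw [hu]; ring
  have hx1 : |t * s - r| ≤ u := hx.trans (mul_le_of_le_one_left hu0 ht)
  have h1 := abs_exp_sub_one_sub_le (t * s - r)
  have h2 : (t * s - r) ^ 2 ≤ t ^ 2 * u ^ 2 := by
    rw [← sq_abs (t * s - r), ← sq_abs t, ← mul_pow]
    exact pow_le_pow_left₀ (abs_nonneg _) hx 2
  have h3 : (t * s - r) ^ 2 * Real.exp |t * s - r| ≤ t ^ 2 * (2 * Real.exp u) * Real.exp u := by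
    refine mul_le_mul (h2.trans ?_) (Real.exp_le_exp.2 hx1) (Real.exp_nonneg _) (by positivity)
    exact mul_le_mul_of_nonneg_left (sq_le_two_mul_exp hu0) (sq_nonneg t)
  have h4 : Real.exp u * Real.exp u = Real.exp (2 * κ) * Real.exp (2 * |s|) := by
    rw [← Real.exp_add, ← Real.exp_add]; congr 1; rw [hu]; ring
  have h5 := exp_two_mul_abs_le s
  have h6 : 1 ≤ Real.exp (2 * |s|) := Real.one_le_exp (by positivity)
  have e : Real.exp (t * s - r) - 1 - t * (s - q) =
      (Real.exp (t * s - r) - 1 - (t * s - r)) - (r - t * q) := by ring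
  rw [e]
  calc _ ≤ |Real.exp (t * s - r) - 1 - (t * s - r)| + |r - t * q| := abs_sub _ _
    _ ≤ t ^ 2 * (2 * Real.exp u) * Real.exp u + t ^ 2 * κ' := by linarith
    _ = t ^ 2 * (2 * (Real.exp u * Real.exp u) + κ') := by ring
    _ ≤ _ := by
      refine mul_le_mul_of_nonneg_left ?_ (sq_nonneg t)
      rw [h4]
      have h7 := mul_le_mul_of_nonneg_left h5 (Real.exp_nonneg (2 * κ))
      have h8 := mul_le_mul_of_nonneg_left (h6.trans h5) hκ'
      linarith

/-! ### Exponential moments and the Mecke formula -/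

section

variable {ν : Measure I} [IsFiniteMeasure ν] {h : I → ℝ} {b : ℝ}

theorem map_fst_jointPow (hh : Measurable h) (k : ℕ) :
    (jointPow ν h k).map Prod.fst = convPow ν k := by
  have : IsFiniteMeasure (tilt ν h 0) := by rw [tilt_zero]; infer_instance
  ext B hB
  rw [← lintegral_indicator_one hB, ← lintegral_indicator_one hB,
    lintegral_map (measurable_one.indicator hB) measurable_fst]
  simpa [tilt_zero] using lintegral_jointPow (t := 0) hh k (measurable_one.indicator hB)

theorem integrable_snd_of_exp {μ : Measure (I × ℝ)}
    (hμ : ∀ t : ℝ, Integrable (fun p : I × ℝ => Real.exp (t * p.2)) μ) :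
    Integrable (fun p : I × ℝ => p.2) μ := by
  refine ((hμ 1).add (hμ (-1))).mono' (by fun_prop) (Eventually.of_forall fun p => ?_)
  simpa using abs_le_exp_add_exp_neg p.2

theorem integrable_exp_jointPow (hh : Measurable h) (hb : ∀ x, |h x| ≤ b) (k : ℕ) (t : ℝ) :
    Integrable (fun p : I × ℝ => Real.exp (t * p.2)) (jointPow ν h k) := by
  have := isFiniteMeasure_tilt (ν := ν) hb t
  have := (convPow_univ (tilt ν h t) k).1
  refine ⟨by fun_prop, ?_⟩
  rw [hasFiniteIntegral_iff_ofReal (Eventually.of_forall fun p => Real.exp_nonneg _)]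
  have := lintegral_jointPow hh (t := t) (ν := ν) k (φ := fun _ => 1) measurable_const
  simp only [one_mul] at this
  rw [this]
  simp

theorem integrable_exp_jointLaw (hh : Measurable h) (hb : ∀ x, |h x| ≤ b) (Δ : ℝ≥0) (t : ℝ) :
    Integrable (fun p : I × ℝ => Real.exp (t * p.2)) (jointLaw Δ ν h) := by
  have := isFiniteMeasure_tilt (ν := ν) hb t
  refine ⟨by fun_prop, ?_⟩
  rw [hasFiniteIntegral_iff_ofReal (Eventually.of_forall fun p => Real.exp_nonneg _)]
  have := lintegral_jointLaw hh (t := t) (ν := ν) Δ (φ := fun _ => 1) measurable_const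
  simp only [one_mul] at this
  rw [this]
  simp

theorem measurable_shiftIntegral (hh : Measurable h) {φ : I → ℝ} (hφ : Measurable φ) :
    Measurable fun x => ∫ y, φ (x + y) * h y ∂ν := by
  have : StronglyMeasurable fun q : I × I => φ (q.1 + q.2) * h q.2 :=
    (show Measurable fun q : I × I => φ (q.1 + q.2) * h q.2 by fun_prop).stronglyMeasurable
  exact this.integral_prod_right'.measurable

theorem abs_shiftIntegral_le (hb : ∀ x, |h x| ≤ b) {φ : I → ℝ} {c : ℝ} (hc : ∀ x, |φ x| ≤ c)
    (x : I) : |∫ y, φ (x + y) * h y ∂ν| ≤ c * b * ν.real Set.univ := by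
  refine norm_integral_le_of_norm_le_const (f := fun y => φ (x + y) * h y)
    (Eventually.of_forall fun y => ?_)
  rw [Real.norm_eq_abs, abs_mul]
  exact mul_le_mul (hc _) (hb _) (abs_nonneg _) ((abs_nonneg _).trans (hc 0))

/-- The Mecke formula for a fixed number of jumps. -/
theorem integral_jointPow_snd (hh : Measurable h) (hb : ∀ x, |h x| ≤ b) (k : ℕ) {φ : I → ℝ}
    (hφ : Measurable φ) {c : ℝ} (hc : ∀ x, |φ x| ≤ c) :
    ∫ p, φ p.1 * p.2 ∂(jointPow ν h k)
      = k * ∫ x, ∫ y, φ (x + y) * h y ∂ν ∂(convPow ν (k - 1)) := by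
  induction k generalizing φ with
  | zero => simp [jointPow, integral_dirac' _ _ (Measurable.stronglyMeasurable
      (show Measurable fun p : I × ℝ => φ p.1 * p.2 by fun_prop))]
  | succ k ih =>
    have hfin : ∀ j, IsFiniteMeasure (convPow ν j) := fun j => (convPow_univ ν j).1
    have hJ : SFinite (jointPow ν h k) := by
      have := isFiniteMeasure_jointPow ν h k
      infer_instance
    have hs : Integrable (fun p : I × ℝ => p.2) (jointPow ν h k) :=
      integrable_snd_of_exp (integrable_exp_jointPow hh hb k)
    have h1 : Integrable (fun q : (I × ℝ) × I => φ (q.1.1 + q.2) * q.1.2)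
        ((jointPow ν h k).prod ν) :=
      (hs.comp_fst ν).bdd_mul (c := c) (Measurable.aestronglyMeasurable (by fun_prop)) (Eventually.of_forall fun q => hc _)
    have h2 : Integrable (fun q : (I × ℝ) × I => φ (q.1.1 + q.2) * h q.2)
        ((jointPow ν h k).prod ν) := by
      refine Integrable.of_bound (by fun_prop) (c * b) (Eventually.of_forall fun q => ?_)
      rw [Real.norm_eq_abs, abs_mul]
      exact mul_le_mul (hc _) (hb _) (abs_nonneg _) ((abs_nonneg _).trans (hc 0))
    rw [jointPow, integral_map (by fun_prop) (by fun_prop)]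
    -- The sum of h splits into the first k jumps and the last one. The former contribute k times
    -- the common value, by induction applied to translates of φ, and the latter contributes it
    -- once.
    simp only [mul_add]
    rw [integral_add h1 h2, integral_prod_symm _ h1, integral_prod _ h2]
    have e2 : ∫ p : I × ℝ, ∫ y, φ (p.1 + y) * h y ∂ν ∂(jointPow ν h k)
        = ∫ x, ∫ y, φ (x + y) * h y ∂ν ∂(convPow ν k) := by
      rw [← map_fst_jointPow (ν := ν) hh k, integral_map (by fun_prop)
        (measurable_shiftIntegral hh hφ).aestronglyMeasurable]
    have e1 : ∫ y, ∫ p : I × ℝ, φ (p.1 + y) * p.2 ∂(jointPow ν h k) ∂ν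
        = k * ∫ x, ∫ y, φ (x + y) * h y ∂ν ∂(convPow ν k) := by
      have : ∀ y, ∫ p : I × ℝ, φ (p.1 + y) * p.2 ∂(jointPow ν h k)
          = k * ∫ x, ∫ z, φ (x + z + y) * h z ∂ν ∂(convPow ν (k - 1)) := fun y =>
        ih (φ := fun x => φ (x + y)) (by fun_prop) fun x => hc _
      simp_rw [this]
      rw [integral_const_mul]
      -- For k = 0 the truncated index k - 1 is harmless because the factor k vanishes. Otherwise
      -- averaging over the last jump restores the missing convolution factor.
      rcases k with _ | k
      · simp
      congr 1
      rw [Nat.add_sub_cancel]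
      have hψ : Integrable (fun x => ∫ y, φ (x + y) * h y ∂ν) ((convPow ν k).conv ν) :=
        Integrable.of_bound (measurable_shiftIntegral hh hφ).aestronglyMeasurable _
          (Eventually.of_forall fun x => abs_shiftIntegral_le hb hc x)
      have hψ' : Integrable (fun q : I × I => ∫ z, φ (q.1 + q.2 + z) * h z ∂ν)
          ((convPow ν k).prod ν) := by
        refine Integrable.of_bound ?_ _
          (Eventually.of_forall fun q => abs_shiftIntegral_le hb hc (q.1 + q.2))
        exact ((measurable_shiftIntegral hh hφ).comp measurable_add).aestronglyMeasurable
      rw [convPow, Measure.conv, integral_map (by fun_prop)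
        (measurable_shiftIntegral hh hφ).aestronglyMeasurable, integral_prod_symm _ hψ']
      simp only [add_right_comm]
    rw [e1, e2, Nat.add_sub_cancel]
    push_cast
    ring

theorem integrable_mul_snd_jointLaw (hh : Measurable h) (hb : ∀ x, |h x| ≤ b) (Δ : ℝ≥0)
    {φ : I → ℝ} (hφ : Measurable φ) {c : ℝ} (hc : ∀ x, |φ x| ≤ c) :
    Integrable (fun p : I × ℝ => φ p.1 * p.2) (jointLaw Δ ν h) :=
  (integrable_snd_of_exp (integrable_exp_jointLaw hh hb Δ)).bdd_mul (c := c)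
    (Measurable.aestronglyMeasurable (by fun_prop)) (Eventually.of_forall fun _ => hc _)

/-- The Mecke formula for the compound Poisson law. -/
theorem integral_jointLaw_snd (hh : Measurable h) (hb : ∀ x, |h x| ≤ b) (Δ : ℝ≥0) {φ : I → ℝ}
    (hφ : Measurable φ) {c : ℝ} (hc : ∀ x, |φ x| ≤ c) :
    ∫ p, φ p.1 * p.2 ∂(jointLaw Δ ν h) = Δ * ∫ x, ∫ y, φ (x + y) * h y ∂ν ∂(law Δ ν) := by
  have hψ : Integrable (fun x => ∫ y, φ (x + y) * h y ∂ν) (law Δ ν) :=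
    Integrable.of_bound (measurable_shiftIntegral hh hφ).aestronglyMeasurable _
      (Eventually.of_forall fun x => abs_shiftIntegral_le hb hc x)
  have s1 := hasSum_integral_measure (μ := fun k : ℕ =>
    ENNReal.ofReal (weight Δ (ν.real Set.univ) k) • jointPow ν h k)
    (integrable_mul_snd_jointLaw hh hb Δ hφ hc)
  have s2 := (hasSum_integral_measure (μ := fun k : ℕ =>
    ENNReal.ofReal (weight Δ (ν.real Set.univ) k) • convPow ν k) hψ).mul_left (Δ : ℝ)
  change HasSum _ (∫ p, φ p.1 * p.2 ∂(jointLaw Δ ν h)) at s1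
  change HasSum _ (Δ * ∫ x, ∫ y, φ (x + y) * h y ∂ν ∂(law Δ ν)) at s2
  -- The no-jump term is zero; after the shift, the jump count k + 1 is absorbed by the weight.
  rw [← hasSum_nat_add_iff' 1] at s1
  simp only [integral_smul_measure, ENNReal.toReal_ofReal (weight_nonneg _ _ _), smul_eq_mul,
    fun k => integral_jointPow_snd (ν := ν) hh hb k hφ hc] at s1 s2
  have e : ∀ k : ℕ, weight Δ (ν.real Set.univ) (k + 1) * ((k + 1 : ℕ) *
      ∫ x, ∫ y, φ (x + y) * h y ∂ν ∂(convPow ν (k + 1 - 1))) =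
      Δ * (weight Δ (ν.real Set.univ) k * ∫ x, ∫ y, φ (x + y) * h y ∂ν ∂(convPow ν k)) := by
    intro k
    rw [← mul_assoc, weight_succ_mul, Nat.add_sub_cancel, mul_assoc]
  simp only [e] at s1
  simpa using s1.unique s2

end

/-! ### Uniform differentiability of the likelihood ratio along tilts -/

theorem tilt_le_volume {ν : Measure I} {h : I → ℝ} {b : ℝ} (hb : ∀ x, |h x| ≤ b) {C : ℝ≥0} (hC : ν ≤ C • (volume : Measure I))
    (t : ℝ) : ∃ C' : ℝ≥0, tilt ν h t ≤ C' • (volume : Measure I) :=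
  ⟨_, (tilt_le ν hb t).trans ((smul_measure_mono _ hC).trans (le_of_eq (smul_smul _ _ _)))⟩

section

variable {ν : Measure I} [IsFiniteMeasure ν] {h : I → ℝ} {b : ℝ}

theorem setIntegral_exp_jointLaw (hh : Measurable h) (hb : ∀ x, |h x| ≤ b) (Δ : ℝ≥0) (t : ℝ)
    {B : Set I} (hB : MeasurableSet B) :
    ∫ p in Prod.fst ⁻¹' B, Real.exp (t * p.2) ∂(jointLaw Δ ν h)
      = Real.exp (Δ * ((tilt ν h t).real Set.univ - ν.real Set.univ)) *
        (law Δ (tilt ν h t)).real B := by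
  have := isFiniteMeasure_tilt (ν := ν) hb t
  rw [integral_eq_lintegral_of_nonneg_ae (Eventually.of_forall fun _ => Real.exp_nonneg _)
    (by fun_prop), ← lintegral_indicator (measurable_fst hB)]
  have e : ∀ p : I × ℝ, (Prod.fst ⁻¹' B).indicator
      (fun p : I × ℝ => ENNReal.ofReal (Real.exp (t * p.2))) p =
      B.indicator 1 p.1 * ENNReal.ofReal (Real.exp (t * p.2)) := fun p => by
    by_cases hp : p.1 ∈ B <;> simp [hp]
  simp_rw [e]
  rw [lintegral_jointLaw hh Δ (measurable_one.indicator hB), lintegral_indicator_one hB,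
    ENNReal.toReal_mul, ENNReal.toReal_ofReal (Real.exp_nonneg _), ← measureReal_def]

theorem real_le_of_le_smul {α : Type*} [MeasurableSpace α] {μ ρ : Measure α} [IsFiniteMeasure ρ]
    {K : ℝ≥0} (hK : μ ≤ K • ρ) (B : Set α) : μ.real B ≤ K * ρ.real B := by
  have e : (K : ℝ) = (K : ℝ≥0∞).toReal := rfl
  rw [measureReal_def, measureReal_def, e, ← ENNReal.toReal_mul]
  refine ENNReal.toReal_mono (ENNReal.mul_ne_top ENNReal.coe_ne_top (measure_ne_top _ _)) ?_
  have h := hK B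
  rwa [Measure.smul_apply, ENNReal.smul_def, smul_eq_mul] at h

/-- In effect, E[e^{tS} | X] is bounded: it is a constant times the density of the tilted law, whose
Lévy measure still has a bounded density. Working with integrals over preimages of Borel sets avoids
conditional expectations. -/
theorem setIntegral_exp_jointLaw_le {Δ : ℝ≥0} (hΔ : 0 < Δ) (hh : Measurable h)
    (hb : ∀ x, |h x| ≤ b) {c : ℝ} (hc : 0 < c) (hcν : ENNReal.ofReal c • (volume : Measure I) ≤ ν)
    {C : ℝ≥0} (hC : ν ≤ C • (volume : Measure I)) (t : ℝ) :
    ∃ K : ℝ, 0 ≤ K ∧ ∀ B, MeasurableSet B →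
      ∫ p in Prod.fst ⁻¹' B, Real.exp (t * p.2) ∂(jointLaw Δ ν h) ≤ K * (law Δ ν).real B := by
  have := isFiniteMeasure_tilt (ν := ν) hb t
  obtain ⟨C', hC'⟩ := tilt_le_volume hb hC t
  obtain ⟨K, hK⟩ := law_le_smul_law hΔ hc hcν hC'
  refine ⟨Real.exp (Δ * ((tilt ν h t).real Set.univ - ν.real Set.univ)) * K, by positivity,
    fun B hB => ?_⟩
  rw [setIntegral_exp_jointLaw hh hb Δ t hB, mul_assoc]
  exact mul_le_mul_of_nonneg_left (real_le_of_le_smul hK B) (Real.exp_nonneg _)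

theorem setIntegral_snd_jointLaw (hh : Measurable h) (hb : ∀ x, |h x| ≤ b) (Δ : ℝ≥0)
    {B : Set I} (hB : MeasurableSet B) :
    ∫ p in Prod.fst ⁻¹' B, p.2 ∂(jointLaw Δ ν h)
      = Δ * ∫ p in (fun p : I × I => p.1 + p.2) ⁻¹' B, h p.1 ∂(ν.prod (law Δ ν)) := by
  have hT : Measurable fun p : I × I => p.1 + p.2 := by fun_prop
  have h1 := integral_jointLaw_snd (ν := ν) hh hb Δ (φ := B.indicator 1)
    (measurable_one.indicator hB) (c := 1) fun x => by
      by_cases hx : x ∈ B <;> simp [hx]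
  have hI : Integrable (((fun p : I × I => p.1 + p.2) ⁻¹' B).indicator fun p : I × I => h p.1)
      (ν.prod (law Δ ν)) :=
    (Integrable.of_bound (Measurable.aestronglyMeasurable (by fun_prop)) b
      (Eventually.of_forall fun p => hb p.1)).indicator (hT hB)
  rw [← integral_indicator (measurable_fst hB), ← integral_indicator (hT hB),
    integral_prod_symm _ hI]
  convert h1 using 3
  · rename_i p
    by_cases hp : p.1 ∈ B <;> simp [hp]
  · ext y
    refine integral_congr_ae (Eventually.of_forall fun x => ?_)
    by_cases hp : y + x ∈ B <;> simp [hp, add_comm x y]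

/-- This identifies the score with E[S - Δ ∫ h dν | X], by the Mecke formula with φ the indicator of
B. -/
theorem setIntegral_score_eq (hh : Measurable h) (hb : ∀ x, |h x| ≤ b) {Δ : ℝ≥0}
    (hac : ν.conv (law Δ ν) ≪ law Δ ν) {B : Set I} (hB : MeasurableSet B) :
    ∫ x in B, score Δ ν h x ∂(law Δ ν)
      = ∫ p in Prod.fst ⁻¹' B, (p.2 - Δ * ∫ x, h x ∂ν) ∂(jointLaw Δ ν h) := by
  have := isProbabilityMeasure_jointLaw (ν := ν) hh Δ
  have hi : Integrable h ν :=
    Integrable.of_bound (by fun_prop) b (Eventually.of_forall hb)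
  rw [setIntegral_score Δ hac hi hB, integral_sub
    (integrable_snd_of_exp (integrable_exp_jointLaw hh hb Δ)).integrableOn
    (integrable_const _).integrableOn, setIntegral_snd_jointLaw hh hb Δ hB, setIntegral_const,
    ← map_measureReal_apply measurable_fst hB, map_fst_jointLaw hh, smul_eq_mul]
  ring

/-- The second-order Taylor remainder of e^{th} is integrated; |t| ≤ 1 keeps the exponential factor
below e^b. It controls the normalising exponent r to second order. -/
theorem abs_tilt_mass_sub_le (hh : Measurable h) (hb : ∀ x, |h x| ≤ b) {t : ℝ} (ht : |t| ≤ 1) :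
    |(tilt ν h t).real Set.univ - ν.real Set.univ - t * ∫ x, h x ∂ν|
      ≤ t ^ 2 * (b ^ 2 * Real.exp b * ν.real Set.univ) := by
  have hb0 : 0 ≤ b := (abs_nonneg _).trans (hb 0)
  have hi : Integrable h ν :=
    Integrable.of_bound (by fun_prop) b (Eventually.of_forall hb)
  have hth : ∀ x, |t * h x| ≤ b := fun x => by
    rw [abs_mul]
    exact (mul_le_of_le_one_left (abs_nonneg _) ht).trans (hb x)
  have he : Integrable (fun x => Real.exp (t * h x)) ν := by
    refine Integrable.of_bound (by fun_prop) (Real.exp b) (Eventually.of_forall fun x => ?_)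
    rw [Real.norm_eq_abs, Real.abs_exp]
    exact Real.exp_le_exp.2 ((le_abs_self _).trans (hth x))
  have e1 : (tilt ν h t).real Set.univ = ∫ x, Real.exp (t * h x) ∂ν := by
    rw [integral_eq_lintegral_of_nonneg_ae (Eventually.of_forall fun _ => Real.exp_nonneg _)
      (by fun_prop), measureReal_def, tilt, withDensity_apply _ MeasurableSet.univ,
      Measure.restrict_univ]
  have e2 : (tilt ν h t).real Set.univ - ν.real Set.univ - t * ∫ x, h x ∂ν
      = ∫ x, (Real.exp (t * h x) - 1 - t * h x) ∂ν := by
    have he1 : Integrable (fun x => Real.exp (t * h x) - 1) ν := he.sub (integrable_const 1)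
    rw [integral_sub he1 (hi.const_mul t),
      integral_sub he (integrable_const 1), integral_const_mul, e1]
    simp
  rw [e2, ← mul_assoc]
  refine norm_integral_le_of_norm_le_const
    (f := fun x => Real.exp (t * h x) - 1 - t * h x) (Eventually.of_forall fun x => ?_)
  refine (abs_exp_sub_one_sub_le _).trans ?_
  rw [mul_pow, mul_assoc]
  refine mul_le_mul_of_nonneg_left ?_ (sq_nonneg t)
  refine mul_le_mul ?_ (Real.exp_le_exp.2 (hth x)) (Real.exp_nonneg _) (sq_nonneg b)
  rw [← sq_abs]
  exact pow_le_pow_left₀ (abs_nonneg _) (hb x) 2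

theorem ae_abs_le_of_setIntegral {α : Type*} [MeasurableSpace α] {μ : Measure α}
    [IsFiniteMeasure μ] {f : α → ℝ} (hf : Integrable f μ) {M : ℝ}
    (h : ∀ B, MeasurableSet B → |∫ x in B, f x ∂μ| ≤ M * μ.real B) : ∀ᵐ x ∂μ, |f x| ≤ M := by
  have h1 : f ≤ᵐ[μ] fun _ => M :=
    ae_le_of_forall_setIntegral_le hf (integrable_const M) fun B hB _ => by
      rw [setIntegral_const, smul_eq_mul, mul_comm]
      exact (le_abs_self _).trans (h B hB)
  have h2 : (fun _ => -M) ≤ᵐ[μ] f :=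
    ae_le_of_forall_setIntegral_le (integrable_const (-M)) hf fun B hB _ => by
      rw [setIntegral_const, smul_eq_mul, mul_comm]
      have := neg_le_of_abs_le (h B hB)
      linarith
  filter_upwards [h1, h2] with x hx1 hx2
  exact abs_le.2 ⟨hx2, hx1⟩

/-- The likelihood ratio of the compound Poisson laws is differentiable along exponential tilts,
uniformly with a quadratic remainder, and its derivative is the score. -/
theorem exists_abs_rnDeriv_tilt_sub_le {Δ : ℝ≥0} (hΔ : 0 < Δ) (hh : Measurable h)
    (hb : ∀ x, |h x| ≤ b) {c : ℝ} (hc : 0 < c) (hcν : ENNReal.ofReal c • (volume : Measure I) ≤ ν)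
    {C : ℝ≥0} (hC : ν ≤ C • (volume : Measure I)) :
    ∃ K : ℝ, 0 ≤ K ∧ ∀ t : ℝ, |t| ≤ 1 → ∀ᵐ x ∂(law Δ ν),
      |((law Δ (tilt ν h t)).rnDeriv (law Δ ν) x).toReal - 1 - t * score Δ ν h x| ≤ K * t ^ 2 := by
  obtain ⟨K₁, hK₁0, hK₁⟩ := setIntegral_exp_jointLaw_le hΔ hh hb hc hcν hC 2
  obtain ⟨K₂, hK₂0, hK₂⟩ := setIntegral_exp_jointLaw_le hΔ hh hb hc hcν hC (-2)
  obtain ⟨K₃, hK₃⟩ := conv_le_smul_law hΔ hc hcν hC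
  have hac : ν.conv (law Δ ν) ≪ law Δ ν :=
    (Measure.absolutelyContinuous_of_le hK₃).trans Measure.smul_absolutelyContinuous
  have hJ := isProbabilityMeasure_jointLaw (ν := ν) hh Δ
  set m := ∫ x, h x ∂ν with hm
  -- Here κ' bounds the second-order error of r, κ its Lipschitz constant at t = 0, and M is the
  -- resulting constant of `abs_exp_tilt_sub_le`.
  set κ' := Δ * (b ^ 2 * Real.exp b * ν.real Set.univ) with hκ'
  have hκ'0 : 0 ≤ κ' := by positivity
  set κ := Δ * |m| + κ' with hκ
  have hκ0 : 0 ≤ κ := by positivity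
  set M := 2 * Real.exp (2 * κ) + κ' with hM
  have hM0 : 0 ≤ M := by positivity
  refine ⟨M * (K₁ + K₂), by positivity, fun t ht => ?_⟩
  have := isFiniteMeasure_tilt (ν := ν) hb t
  obtain ⟨C', hC'⟩ := tilt_le_volume hb hC t
  obtain ⟨K₄, hK₄⟩ := law_le_smul_law hΔ hc hcν hC'
  have hact : law Δ (tilt ν h t) ≪ law Δ ν :=
    (Measure.absolutelyContinuous_of_le hK₄).trans Measure.smul_absolutelyContinuous
  set r := Δ * ((tilt ν h t).real Set.univ - ν.real Set.univ) with hr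
  have hr' : |r - t * (Δ * m)| ≤ t ^ 2 * κ' := by
    have := mul_le_mul_of_nonneg_left (abs_tilt_mass_sub_le (ν := ν) hh hb ht) (NNReal.coe_nonneg Δ)
    rw [← abs_of_nonneg (NNReal.coe_nonneg Δ), ← abs_mul,
      abs_of_nonneg (NNReal.coe_nonneg Δ)] at this
    calc |r - t * (Δ * m)|
        = |Δ * ((tilt ν h t).real Set.univ - ν.real Set.univ - t * ∫ x, h x ∂ν)| := by
          rw [hr, hm]; congr 1; ring
      _ ≤ _ := this
      _ = t ^ 2 * κ' := by rw [hκ']; ring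
  have hr1 : |r| ≤ |t| * κ := by
    have h1 : |r| ≤ |r - t * (Δ * m)| + |t * (Δ * m)| := by
      simpa using abs_add_le (r - t * (Δ * m)) (t * (Δ * m))
    have h2 : |t * (Δ * m)| = |t| * (Δ * |m|) := by
      rw [abs_mul, abs_mul, abs_of_nonneg (NNReal.coe_nonneg Δ)]
    have h3 : t ^ 2 * κ' ≤ |t| * κ' := by
      refine mul_le_mul_of_nonneg_right ?_ hκ'0
      rw [← sq_abs, sq]
      exact mul_le_of_le_one_left (abs_nonneg t) ht
    rw [hκ, mul_add]
    linarith
  have hs : Integrable (fun p : I × ℝ => p.2 - Δ * m) (jointLaw Δ ν h) :=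
    (integrable_snd_of_exp (integrable_exp_jointLaw hh hb Δ)).sub (integrable_const _)
  have hL : Integrable (fun p : I × ℝ => Real.exp (t * p.2 - r)) (jointLaw Δ ν h) := by
    simp_rw [Real.exp_sub]
    exact (integrable_exp_jointLaw hh hb Δ t).div_const _
  have hE : Integrable (fun p : I × ℝ => Real.exp (2 * p.2) + Real.exp (-2 * p.2))
      (jointLaw Δ ν h) :=
    (integrable_exp_jointLaw hh hb Δ 2).add (integrable_exp_jointLaw hh hb Δ (-2))
  have hR : Integrable (fun x => ((law Δ (tilt ν h t)).rnDeriv (law Δ ν) x).toReal) (law Δ ν) :=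
    Measure.integrable_toReal_rnDeriv
  have hA := integrable_score Δ ν h
  have hR1 : Integrable (fun x => ((law Δ (tilt ν h t)).rnDeriv (law Δ ν) x).toReal - 1)
      (law Δ ν) := hR.sub (integrable_const 1)
  have hL1 : Integrable (fun p : I × ℝ => Real.exp (t * p.2 - r) - 1) (jointLaw Δ ν h) :=
    hL.sub (integrable_const 1)
  have hR2 : Integrable (fun x => ((law Δ (tilt ν h t)).rnDeriv (law Δ ν) x).toReal - 1
      - t * score Δ ν h x) (law Δ ν) := hR1.sub (hA.const_mul t)
  refine ae_abs_le_of_setIntegral hR2 fun B hB => ?_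
  have hB' : MeasurableSet (Prod.fst ⁻¹' B : Set (I × ℝ)) := measurable_fst hB
  -- Integrated over B, the ratio, 1 and the score become integrals of e^{tS - r}, 1 and S - Δm over
  -- the preimage of B, so the pointwise inequality in S applies.
  have e1 : ∫ x in B, (((law Δ (tilt ν h t)).rnDeriv (law Δ ν) x).toReal - 1
      - t * score Δ ν h x) ∂(law Δ ν) =
      ∫ p in Prod.fst ⁻¹' B, (Real.exp (t * p.2 - r) - 1 - t * (p.2 - Δ * m))
        ∂(jointLaw Δ ν h) := by
    rw [integral_sub hR1.integrableOn (hA.const_mul t).integrableOn,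
      integral_sub hR.integrableOn (integrable_const 1).integrableOn, integral_const_mul,
      integral_sub hL1.integrableOn (hs.const_mul t).integrableOn,
      integral_sub hL.integrableOn (integrable_const 1).integrableOn, integral_const_mul,
      setIntegral_score_eq hh hb hac hB, Measure.setIntegral_toReal_rnDeriv hact,
      setIntegral_const, setIntegral_const, ← map_measureReal_apply measurable_fst hB,
      map_fst_jointLaw hh]
    simp_rw [Real.exp_sub]
    rw [integral_div, setIntegral_exp_jointLaw hh hb Δ t hB, ← hr,
      mul_div_cancel_left₀ _ (Real.exp_pos r).ne']
  rw [e1]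
  calc _ ≤ ∫ p in Prod.fst ⁻¹' B, |Real.exp (t * p.2 - r) - 1 - t * (p.2 - Δ * m)|
        ∂(jointLaw Δ ν h) := abs_integral_le_integral_abs
    _ ≤ ∫ p in Prod.fst ⁻¹' B, t ^ 2 * (M * (Real.exp (2 * p.2) + Real.exp (-2 * p.2)))
        ∂(jointLaw Δ ν h) := by
        refine integral_mono (hL1.sub (hs.const_mul t)).abs.integrableOn
          ((hE.const_mul M).const_mul _).integrableOn fun p => ?_
        exact abs_exp_tilt_sub_le ht hκ0 hκ'0 hr1 hr'
    _ = t ^ 2 * (M * ((∫ p in Prod.fst ⁻¹' B, Real.exp (2 * p.2) ∂(jointLaw Δ ν h)) +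
          ∫ p in Prod.fst ⁻¹' B, Real.exp (-2 * p.2) ∂(jointLaw Δ ν h))) := by
        rw [integral_const_mul, integral_const_mul, integral_add
          (integrable_exp_jointLaw hh hb Δ 2).integrableOn
          (integrable_exp_jointLaw hh hb Δ (-2)).integrableOn]
    _ ≤ t ^ 2 * (M * (K₁ * (law Δ ν).real B + K₂ * (law Δ ν).real B)) := by
        have := hK₁ B hB
        have := hK₂ B hB
        gcongr
    _ = _ := by ring

/-- Likelihood ratios are nonnegative, so the expansion at t = 1 bounds the score from below and the
one at t = -1 bounds it from above. -/
theorem ae_abs_score_le {Δ : ℝ≥0} (hΔ : 0 < Δ) (hh : Measurable h)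
    (hb : ∀ x, |h x| ≤ b) {c : ℝ} (hc : 0 < c) (hcν : ENNReal.ofReal c • (volume : Measure I) ≤ ν)
    {C : ℝ≥0} (hC : ν ≤ C • (volume : Measure I)) :
    ∃ a : ℝ, 0 ≤ a ∧ ∀ᵐ x ∂(law Δ ν), |score Δ ν h x| ≤ a := by
  obtain ⟨K, hK0, hK⟩ := exists_abs_rnDeriv_tilt_sub_le hΔ hh hb hc hcν hC
  refine ⟨1 + K, by positivity, ?_⟩
  filter_upwards [hK 1 (by simp), hK (-1) (by simp)] with x h1 h2
  have r1 : 0 ≤ ((law Δ (tilt ν h 1)).rnDeriv (law Δ ν) x).toReal := ENNReal.toReal_nonneg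
  have r2 : 0 ≤ ((law Δ (tilt ν h (-1))).rnDeriv (law Δ ν) x).toReal := ENNReal.toReal_nonneg
  have h1 := abs_le.1 h1
  have h2 := abs_le.1 h2
  exact abs_le.2 ⟨by linarith, by linarith⟩

end

/-! ### From a uniform expansion to local asymptotic normality -/

/-- A weak law for row sums of a triangular array of identically distributed, bounded variables
whose means are of smaller order. -/
theorem tendstoInMeasure_sum_of_ae_bound {Ω E : Type*} [MeasurableSpace Ω] [MeasurableSpace E]
    {Q : Measure Ω} [IsProbabilityMeasure Q] {P : Measure E} [IsProbabilityMeasure P]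
    {X : ℕ → Ω → E} (hX : ∀ i, HasLaw (X i) P Q) (hind : iIndepFun X Q) {ξ : ℕ → E → ℝ}
    (hξ : ∀ n, Measurable (ξ n)) {K : ℝ}
    (hK : ∀ᶠ n : ℕ in atTop, ∀ᵐ x ∂P, |ξ n x| ≤ K * (1 / √(n : ℝ)) ^ 2)
    (hmean : ∀ᶠ n : ℕ in atTop, |∫ x, ξ n x ∂P| ≤ K * (1 / √(n : ℝ)) ^ 3) :
    TendstoInMeasure Q (fun (n : ℕ) ω => ∑ i ∈ Finset.range n, ξ n (X i ω)) atTop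
      (fun _ => 0) := by
  rw [tendstoInMeasure_iff_measureReal_norm]
  intro ε hε
  -- The second moment of the row sum is at most 2K²/n: the variance gives n (K/n)² and the squared
  -- mean (n K n^{-3/2})². Markov's inequality divides by ε².
  have hlim : Tendsto (fun n : ℕ => 2 * K ^ 2 / ε ^ 2 * (1 / (n : ℝ))) atTop (𝓝 0) := by
    have h0 := (tendsto_one_div_atTop_nhds_zero_nat (𝕜 := ℝ)).const_mul (2 * K ^ 2 / ε ^ 2)
    rwa [mul_zero] at h0
  refine squeeze_zero' (Eventually.of_forall fun n => measureReal_nonneg) ?_ hlim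
  filter_upwards [hK, hmean, eventually_gt_atTop 0] with n hn hm hn0
  set t : ℝ := 1 / √(n : ℝ) with ht
  have hnr : (0 : ℝ) < n := by exact_mod_cast hn0
  have ht2 : t ^ 2 = 1 / n := by rw [ht, div_pow, Real.sq_sqrt hnr.le, one_pow]
  set Y : ℕ → Ω → ℝ := fun i ω => ξ n (X i ω) with hY
  have hYm : ∀ i, AEMeasurable (Y i) Q := fun i => (hξ n).comp_aemeasurable (hX i).aemeasurable
  have hYb : ∀ i, ∀ᵐ ω ∂Q, |Y i ω| ≤ K * t ^ 2 := fun i => by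
    have h1 := hn
    rw [← (hX i).map_eq] at h1
    exact ae_of_ae_map (hX i).aemeasurable h1
  have hY2 : ∀ i, MemLp (Y i) 2 Q := fun i =>
    MemLp.of_bound (hYm i).aestronglyMeasurable _ (hYb i)
  have hYint : ∀ i, ∫ ω, Y i ω ∂Q = ∫ x, ξ n x ∂P := fun i => by
    rw [← (hX i).map_eq, integral_map (hX i).aemeasurable (hξ n).aestronglyMeasurable]
  have hvar : ∀ i, Var[Y i; Q] ≤ (K * t ^ 2) ^ 2 := fun i => by
    refine (variance_le_expectation_sq (hYm i).aestronglyMeasurable).trans ?_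
    calc ∫ ω, (Y i ^ 2) ω ∂Q ≤ ∫ _, (K * t ^ 2) ^ 2 ∂Q := by
          refine integral_mono_ae (hY2 i).integrable_sq (integrable_const _) ?_
          filter_upwards [hYb i] with ω hω
          simp only [Pi.pow_apply]
          rw [← sq_abs]
          exact pow_le_pow_left₀ (abs_nonneg _) hω 2
      _ = _ := by simp
  set S : Ω → ℝ := ∑ i ∈ Finset.range n, Y i with hS
  have hS2 : MemLp S 2 Q := memLp_finsetSum' _ fun i _ => hY2 i
  have hvS : Var[S; Q] ≤ K ^ 2 * (1 / n) := by
    rw [hS, IndepFun.variance_sum (fun i _ => hY2 i) fun i _ j _ hij =>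
      (hind.comp (fun _ => ξ n) fun _ => hξ n).indepFun hij]
    calc ∑ i ∈ Finset.range n, Var[Y i; Q] ≤ ∑ i ∈ Finset.range n, (K * t ^ 2) ^ 2 :=
          Finset.sum_le_sum fun i _ => hvar i
      _ = K ^ 2 * (1 / n) := by
          rw [Finset.sum_const, Finset.card_range, nsmul_eq_mul, ht2]
          field_simp
  have hmS : (∫ ω, S ω ∂Q) ^ 2 ≤ K ^ 2 * (1 / n) := by
    have e : ∫ ω, S ω ∂Q = n * ∫ x, ξ n x ∂P := by
      simp only [hS, Finset.sum_apply]
      rw [integral_finsetSum _ fun i _ => (hY2 i).integrable one_le_two]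
      simp [hYint]
    rw [e, mul_pow, ← sq_abs (∫ x, ξ n x ∂P)]
    calc (n : ℝ) ^ 2 * |∫ x, ξ n x ∂P| ^ 2 ≤ (n : ℝ) ^ 2 * (K * t ^ 3) ^ 2 := by
          gcongr
      _ = n ^ 2 * K ^ 2 * (t ^ 2) ^ 3 := by ring
      _ = K ^ 2 * (1 / n) := by rw [ht2]; field_simp
  have hES : ∫ ω, S ω ^ 2 ∂Q ≤ 2 * K ^ 2 * (1 / n) := by
    have := variance_eq_sub hS2
    simp only [Pi.pow_apply] at this
    linarith
  have hmarkov := mul_meas_ge_le_integral_of_nonneg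
    (Eventually.of_forall fun ω => sq_nonneg (S ω)) hS2.integrable_sq (ε ^ 2)
  have hset : {ω | ε ≤ ‖∑ i ∈ Finset.range n, ξ n (X i ω) - 0‖} = {ω | ε ^ 2 ≤ S ω ^ 2} := by
    ext ω
    simp only [Set.mem_ofPred_eq, sub_zero, Real.norm_eq_abs, hS, Finset.sum_apply, hY]
    rw [sq_le_sq, abs_of_pos hε]
  rw [hset, div_mul_eq_mul_div, le_div_iff₀ (by positivity), mul_comm]
  exact hmarkov.trans hES

/-- Second order expansion of the logarithm of a likelihood ratio. -/
theorem abs_log_sub_le {R A t a K : ℝ} (hK : 0 ≤ K) (ht : 0 ≤ t) (ht1 : t ≤ 1)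
    (htL : t * (a + K) ≤ 1 / 2) (hA : |A| ≤ a) (hR : |R - 1 - t * A| ≤ K * t ^ 2) :
    |Real.log R - (R - 1) + t ^ 2 * A ^ 2 / 2| ≤
      (2 * (a + K) ^ 3 + K * (a + K)) * t ^ 3 := by
  have ha : 0 ≤ a := (abs_nonneg A).trans hA
  set L := a + K with hL
  have hL0 : 0 ≤ L := by positivity
  have hK2 : K * t ^ 2 ≤ t * K := by nlinarith [mul_nonneg hK ht]
  have htA : |t * A| ≤ t * a := by
    rw [abs_mul, abs_of_nonneg ht]; exact mul_le_mul_of_nonneg_left hA ht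
  set u := R - 1 with hu
  have hu1 : |u| ≤ t * L := by
    have := abs_add_le (u - t * A) (t * A)
    rw [sub_add_cancel] at this
    rw [hL, mul_add]; linarith
  have hu2 : |u| ≤ 1 / 2 := hu1.trans htL
  -- Two terms of the series of log(1 - x) at x = -u leave the remainder |u|³/(1 - |u|); the
  -- denominator is at least 1/2.
  have h1 := Real.abs_log_sub_add_sum_range_le (x := -u) (by rw [abs_neg]; linarith) 2
  rw [Finset.sum_range_succ, Finset.sum_range_one, abs_neg] at h1
  have e : 1 - -u = R := by rw [hu]; ring
  rw [e] at h1
  norm_num at h1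
  have h2 : |u| ^ 3 / (1 - |u|) ≤ 2 * L ^ 3 * t ^ 3 := by
    rw [div_le_iff₀ (by linarith)]
    have h3 : |u| ^ 3 ≤ (t * L) ^ 3 := pow_le_pow_left₀ (abs_nonneg u) hu1 3
    have h4 : 0 ≤ (t * L) ^ 3 := by positivity
    nlinarith
  have h5 : |u ^ 2 - t ^ 2 * A ^ 2| ≤ K * t ^ 2 * (2 * (t * L)) := by
    have : u ^ 2 - t ^ 2 * A ^ 2 = (u - t * A) * (u + t * A) := by ring
    rw [this, abs_mul]
    refine mul_le_mul hR ?_ (abs_nonneg _) (by positivity)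
    have h6 := abs_add_le u (t * A)
    have h7 : t * a ≤ t * L := mul_le_mul_of_nonneg_left (by linarith) ht
    linarith
  have e2 : Real.log R - u + t ^ 2 * A ^ 2 / 2 =
      (-u + u ^ 2 / 2 + Real.log R) - (u ^ 2 - t ^ 2 * A ^ 2) / 2 := by ring
  rw [e2]
  refine (abs_sub _ _).trans ?_
  rw [abs_div, abs_two]
  have h8 := h1.trans h2
  linarith

section

variable {α : Type*} [MeasurableSpace α] {P : Measure α} [IsProbabilityMeasure P]
  {R : ℝ → α → ℝ} {A : α → ℝ} {a K : ℝ}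

/-- Local asymptotic normality for likelihood ratios with a uniform first order expansion. -/
theorem tendstoInMeasure_log_expansion {Ω : Type*} [MeasurableSpace Ω] {Q : Measure Ω}
    [IsProbabilityMeasure Q] {X : ℕ → Ω → α} (hX : ∀ i, HasLaw (X i) P Q) (hind : iIndepFun X Q)
    (hRm : ∀ t, Measurable (R t)) (hAm : Measurable A) (hK : 0 ≤ K)
    (hA : ∀ᵐ x ∂P, |A x| ≤ a)
    (hR : ∀ t, |t| ≤ 1 → ∀ᵐ x ∂P, |R t x - 1 - t * A x| ≤ K * t ^ 2)
    (hRint : ∀ t, |t| ≤ 1 → ∫ x, R t x ∂P = 1) (hAint : ∫ x, A x ∂P = 0) :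
    TendstoInMeasure Q (fun (n : ℕ) ω => ∑ i ∈ Finset.range n,
      (Real.log (R (1 / √(n : ℝ)) (X i ω)) - 1 / √(n : ℝ) * A (X i ω)
        + (1 / √(n : ℝ)) ^ 2 * (∫ x, A x ^ 2 ∂P) / 2)) atTop (fun _ => 0) := by
  set σ := ∫ x, A x ^ 2 ∂P with hσ
  have ha : 0 ≤ a := by
    obtain ⟨x, hx⟩ := hA.exists
    exact (abs_nonneg _).trans hx
  have hA2 : ∀ᵐ x ∂P, A x ^ 2 ≤ a ^ 2 := hA.mono fun x hx => by
    rw [← sq_abs]; exact pow_le_pow_left₀ (abs_nonneg _) hx 2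
  have hAi : Integrable A P := Integrable.of_bound hAm.aestronglyMeasurable a hA
  have hA2i : Integrable (fun x => A x ^ 2) P :=
    Integrable.of_bound (hAm.pow_const 2).aestronglyMeasurable (a ^ 2) (hA2.mono fun x hx => by
      rwa [Real.norm_eq_abs, abs_of_nonneg (sq_nonneg _)])
  have hσ0 : 0 ≤ σ := integral_nonneg fun x => sq_nonneg _
  have hσa : σ ≤ a ^ 2 := by
    have := integral_mono_ae hA2i (integrable_const (a ^ 2)) hA2
    simpa using this
  set K' := 2 * (a + K) ^ 3 + K * (a + K) with hK'
  have hK'0 : 0 ≤ K' := by positivity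
  have hsmall : ∀ᶠ n : ℕ in atTop, 1 / √(n : ℝ) * (a + K) ≤ 1 / 2 := by
    have h0 : Tendsto (fun n : ℕ => 1 / √(n : ℝ) * (a + K)) atTop (𝓝 0) := by
      have h1 : Tendsto (fun n : ℕ => √(n : ℝ)) atTop atTop :=
        Real.tendsto_sqrt_atTop.comp tendsto_natCast_atTop_atTop
      simpa using (h1.const_div_atTop 1).mul_const (a + K)
    exact h0.eventually (ge_mem_nhds (by norm_num))
  have ht1 : ∀ n : ℕ, 0 < n → 1 / √(n : ℝ) ≤ 1 := fun n hn => by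
    rw [div_le_one (by positivity), Real.one_le_sqrt]
    exact_mod_cast hn
  -- The summand is the logarithmic remainder, plus R - 1 - tA, plus t²(σ - A²)/2. These are at most
  -- K't³, Kt² and a²t², and the sum of the three constants serves for both the size and the mean.
  refine tendstoInMeasure_sum_of_ae_bound (K := K + a ^ 2 + K') hX hind
    (ξ := fun n x => Real.log (R (1 / √(n : ℝ)) x) - 1 / √(n : ℝ) * A x
      + (1 / √(n : ℝ)) ^ 2 * σ / 2) (fun n => by have := hRm (1 / √(n : ℝ)); fun_prop) ?_ ?_
  · filter_upwards [hsmall, eventually_gt_atTop 0] with n hn hn0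
    have ht0 : 0 ≤ 1 / √(n : ℝ) := by positivity
    have htn := ht1 n hn0
    set t : ℝ := 1 / √(n : ℝ)
    filter_upwards [hA, hA2, hR t (by rwa [abs_of_nonneg ht0])] with x hx hx2 hRx
    have h1 := abs_le.1 (abs_log_sub_le hK ht0 htn hn hx hRx)
    have h2 := abs_le.1 hRx
    have h3 : K' * t ^ 3 ≤ K' * t ^ 2 :=
      mul_le_mul_of_nonneg_left (pow_le_pow_of_le_one ht0 htn (by norm_num)) hK'0
    have h4 : t ^ 2 * A x ^ 2 ≤ t ^ 2 * a ^ 2 := mul_le_mul_of_nonneg_left hx2 (sq_nonneg t)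
    have h5 : t ^ 2 * σ ≤ t ^ 2 * a ^ 2 := mul_le_mul_of_nonneg_left hσa (sq_nonneg t)
    have h6 : 0 ≤ t ^ 2 * A x ^ 2 := by positivity
    have h7 : 0 ≤ t ^ 2 * σ := by positivity
    rw [← hK'] at h1
    refine abs_le.2 ⟨?_, ?_⟩
    · linarith
    · linarith
  · filter_upwards [hsmall, eventually_gt_atTop 0] with n hn hn0
    have ht0 : 0 ≤ 1 / √(n : ℝ) := by positivity
    have htn := ht1 n hn0
    set t : ℝ := 1 / √(n : ℝ)
    have hRt := hR t (by rwa [abs_of_nonneg ht0])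
    have hD : Integrable (fun x => R t x - 1 - t * A x) P := by
      refine Integrable.of_bound ?_ (K * t ^ 2) hRt
      have := hRm t
      exact Measurable.aestronglyMeasurable (by fun_prop)
    have hRi : Integrable (R t) P := by
      refine ((hD.add (hAi.const_mul t)).add (integrable_const 1)).congr
        (Eventually.of_forall fun x => ?_)
      simp only [Pi.add_apply]
      ring
    have hbd : ∀ᵐ x ∂P, ‖Real.log (R t x) - (R t x - 1) + t ^ 2 * A x ^ 2 / 2‖ ≤ K' * t ^ 3 := by
      filter_upwards [hA, hRt] with x hx hRx
      exact abs_log_sub_le hK ht0 htn hn hx hRx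
    have hGi : Integrable (fun x => Real.log (R t x) - (R t x - 1) + t ^ 2 * A x ^ 2 / 2) P := by
      refine Integrable.of_bound ?_ _ hbd
      have := hRm t
      exact Measurable.aestronglyMeasurable (by fun_prop)
    have hR1i : Integrable (fun x => R t x - 1) P := hRi.sub (integrable_const 1)
    have hA2i' : Integrable (fun x => t ^ 2 * A x ^ 2 / 2) P := (hA2i.const_mul _).div_const 2
    -- The parts R - 1 - tA and t²(σ - A²)/2 have mean zero, so only the remainder of order t³
    -- contributes to the mean.
    have e : ∫ x, (Real.log (R t x) - t * A x + t ^ 2 * σ / 2) ∂P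
        = ∫ x, (Real.log (R t x) - (R t x - 1) + t ^ 2 * A x ^ 2 / 2) ∂P := by
      have e1 : ∀ x, Real.log (R t x) - t * A x + t ^ 2 * σ / 2
          = (Real.log (R t x) - (R t x - 1) + t ^ 2 * A x ^ 2 / 2) +
            (((R t x - 1) - t * A x) + (t ^ 2 * σ / 2 - t ^ 2 * A x ^ 2 / 2)) := fun x => by ring
      have i1 : Integrable (fun x => t ^ 2 * σ / 2 - t ^ 2 * A x ^ 2 / 2) P :=
        (integrable_const _).sub hA2i'
      have i2 : Integrable (fun x => ((R t x - 1) - t * A x) +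
          (t ^ 2 * σ / 2 - t ^ 2 * A x ^ 2 / 2)) P := hD.add i1
      have e2 : ∫ x, t ^ 2 * A x ^ 2 / 2 ∂P = t ^ 2 * σ / 2 := by
        rw [integral_div, integral_const_mul]
      simp_rw [e1]
      rw [integral_add hGi i2, integral_add hD i1, integral_sub hR1i (hAi.const_mul t),
        integral_sub hRi (integrable_const 1), integral_sub (integrable_const _) hA2i',
        hRint t (by rwa [abs_of_nonneg ht0]), integral_const_mul, hAint, e2]
      simp
    rw [e]
    have h1 := norm_integral_le_of_norm_le_const hbd
    rw [probReal_univ, mul_one] at h1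
    refine h1.trans (mul_le_mul_of_nonneg_right ?_ (by positivity))
    nlinarith [sq_nonneg a]

end

/-! ### Lévy densities, likelihoods and the conclusion -/

theorem smul_volume_le_levyMeasure {v : I → ℝ} {c : ℝ} (hlow : ∀ᵐ x, c ≤ Real.exp (v x)) :
    ENNReal.ofReal c • (volume : Measure I) ≤ levyMeasure v := by
  rw [← withDensity_const, levyMeasure]
  exact withDensity_mono (hlow.mono fun x hx => ENNReal.ofReal_le_ofReal hx)

theorem levyMeasure_le_smul_volume {v : I → ℝ} {C : ℝ} (hupp : ∀ᵐ x, Real.exp (v x) ≤ C) :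
    levyMeasure v ≤ C.toNNReal • (volume : Measure I) := by
  change _ ≤ ENNReal.ofReal C • (volume : Measure I)
  rw [← withDensity_const, levyMeasure]
  exact withDensity_mono (hupp.mono fun x hx => ENNReal.ofReal_le_ofReal hx)

/-- The local perturbation is a tilt with t = 1/√n. The case s = 0 is covered because division by
zero gives zero on both sides, so n = 0 needs no exception. -/
theorem levyMeasure_add_eq_tilt {v h h' : I → ℝ} (hv : Measurable v) (hh' : Measurable h')
    (hhh' : h =ᵐ[volume] h') (s : ℝ) :
    levyMeasure (fun x => v x + h x / s) = tilt (levyMeasure v) h' (1 / s) := by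
  rw [tilt, levyMeasure, levyMeasure, ← withDensity_mul _ (by fun_prop) (by fun_prop)]
  refine withDensity_congr_ae (hhh'.mono fun x hx => ?_)
  simp only [Pi.mul_apply]
  rw [← ENNReal.ofReal_mul (Real.exp_nonneg _), ← Real.exp_add, hx]
  congr 3
  ring

theorem smul_volume_le_tilt {ν : Measure I} {h : I → ℝ} {b : ℝ} (hb : ∀ x, |h x| ≤ b) {c : ℝ}
    (hcν : ENNReal.ofReal c • (volume : Measure I) ≤ ν) (t : ℝ) :
    ENNReal.ofReal (Real.exp (-(|t| * b)) * c) • (volume : Measure I) ≤ tilt ν h t := by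
  refine Measure.le_iff.2 fun B hB => ?_
  rw [ENNReal.ofReal_mul (Real.exp_nonneg _), mul_smul, tilt, withDensity_apply _ hB]
  calc _ ≤ ENNReal.ofReal (Real.exp (-(|t| * b))) * ν B :=
        mul_le_mul' le_rfl (hcν B)
    _ = ∫⁻ _ in B, ENNReal.ofReal (Real.exp (-(|t| * b))) ∂ν := by simp
    _ ≤ _ := by
        refine lintegral_mono fun x => ENNReal.ofReal_le_ofReal (Real.exp_le_exp.2 ?_)
        refine neg_le_of_abs_le ?_
        rw [abs_mul]
        exact mul_le_mul_of_nonneg_left (hb x) (abs_nonneg t)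

theorem law_absolutelyContinuous {Δ : ℝ≥0} (hΔ : 0 < Δ) {ν ν' : Measure I} [SFinite ν]
    [IsFiniteMeasure ν'] {c : ℝ} (hc : 0 < c) (h : ENNReal.ofReal c • (volume : Measure I) ≤ ν)
    {C : ℝ≥0} (h' : ν' ≤ C • (volume : Measure I)) : law Δ ν' ≪ law Δ ν := by
  obtain ⟨K, hK⟩ := law_le_smul_law hΔ hc h h'
  exact (Measure.absolutelyContinuous_of_le hK).trans Measure.smul_absolutelyContinuous

theorem law_absolutelyContinuous_refLaw {Δ : ℝ≥0} (hΔ : 0 < Δ) {ν : Measure I} [IsFiniteMeasure ν]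
    {C : ℝ≥0} (h : ν ≤ C • (volume : Measure I)) : law Δ ν ≪ refLaw Δ :=
  law_absolutelyContinuous hΔ one_pos (by simp) h

/-- A density is positive almost surely under its own law; domination carries this over to the law
of the observations. -/
theorem ae_density_pos {Δ : ℝ≥0} {ν ν' : Measure I} [IsFiniteMeasure ν] [IsFiniteMeasure ν']
    (h : law Δ ν ≪ law Δ ν') (h' : law Δ ν' ≪ refLaw Δ) :
    ∀ᵐ x ∂(law Δ ν), 0 < density Δ ν' x := by
  have : IsProbabilityMeasure (refLaw Δ) := isProbabilityMeasure_law Δ volume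
  have : SFinite (law Δ ν') := by
    have := isProbabilityMeasure_law Δ ν'
    infer_instance
  filter_upwards [h.ae_le (Measure.rnDeriv_pos h'),
    (h.trans h').ae_le (Measure.rnDeriv_lt_top (law Δ ν') (refLaw Δ))] with x hx hx'
  exact ENNReal.toReal_pos hx.ne' hx'.ne

theorem ae_density_eq_mul {Δ : ℝ≥0} {ν ν' : Measure I} [IsFiniteMeasure ν] [IsFiniteMeasure ν']
    (h : law Δ ν' ≪ law Δ ν) (h' : law Δ ν ≪ refLaw Δ) :
    ∀ᵐ x ∂(law Δ ν),
      density Δ ν' x = ((law Δ ν').rnDeriv (law Δ ν) x).toReal * density Δ ν x := by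
  have : IsProbabilityMeasure (refLaw Δ) := isProbabilityMeasure_law Δ volume
  filter_upwards [h'.ae_le (Measure.rnDeriv_mul_rnDeriv (κ := refLaw Δ) h)] with x hx
  rw [density, density, ← ENNReal.toReal_mul, ← hx, Pi.mul_apply]

/-- An essentially bounded function agrees almost everywhere with a bounded Borel function. -/
theorem exists_measurable_bounded_ae_eq {α : Type*} [MeasurableSpace α] {μ : Measure α} {h : α → ℝ}
    (hh : MemLp h ∞ μ) :
    ∃ (h' : α → ℝ) (b : ℝ), Measurable h' ∧ (∀ x, |h' x| ≤ b) ∧ h =ᵐ[μ] h' := by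
  set b := (eLpNorm h ∞ μ).toReal
  have hb : ∀ᵐ x ∂μ, |h x| ≤ b := by
    have h1 := ae_le_eLpNormEssSup (f := h) (μ := μ)
    filter_upwards [h1] with x hx
    rw [← eLpNorm_exponent_top] at hx
    have := ENNReal.toReal_mono hh.2.ne hx
    rwa [toReal_enorm, Real.norm_eq_abs] at this
  have hb0 : 0 ≤ b := ENNReal.toReal_nonneg
  have hg : Measurable (hh.1.mk h) := hh.1.stronglyMeasurable_mk.measurable
  refine ⟨fun x => max (-b) (min b (hh.1.mk h x)), b, by fun_prop, fun x => ?_, ?_⟩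
  · exact abs_le.2 ⟨le_max_left _ _, max_le (by linarith) (min_le_left _ _)⟩
  · filter_upwards [hh.1.ae_eq_mk, hb] with x hx hbx
    rw [← hx, min_eq_right (abs_le.1 hbx).2, max_eq_right (abs_le.1 hbx).1]

theorem likelihood_pos {Δ : ℝ≥0} {ν : Measure I} {n : ℕ} {x : ℕ → I}
    (h : ∀ i, 0 < density Δ ν (x i)) : 0 < likelihood Δ ν n x :=
  Finset.prod_pos fun i _ => h i

theorem logLikelihood_sub_eq_sum {Δ : ℝ≥0} {ν ν' : Measure I} {n : ℕ} {x : ℕ → I} {R : I → ℝ}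
    (h : ∀ i, 0 < density Δ ν (x i)) (h' : ∀ i, 0 < density Δ ν' (x i))
    (hR : ∀ i, density Δ ν' (x i) = R (x i) * density Δ ν (x i)) :
    logLikelihood Δ ν' n x - logLikelihood Δ ν n x
      = ∑ i ∈ Finset.range n, Real.log (R (x i)) := by
  rw [logLikelihood, logLikelihood, likelihood, likelihood,
    Real.log_prod fun i _ => (h' i).ne', Real.log_prod fun i _ => (h i).ne',
    ← Finset.sum_sub_distrib]
  refine Finset.sum_congr rfl fun i _ => ?_
  have hRi : R (x i) ≠ 0 := fun h0 => by
    have := h' i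
    rw [hR i, h0, zero_mul] at this
    exact lt_irrefl _ this
  rw [hR i, Real.log_mul hRi (h i).ne', add_sub_cancel_right]

end CompoundPoisson

open CompoundPoisson
theorem proposition1 (Δ : ℝ≥0) (hΔ : 0 < Δ) (v : I → ℝ) (hv : Measurable v) (c C : ℝ) (hc : 0 < c)
    (hlow : ∀ᵐ x, c ≤ Real.exp (v x)) (hupp : ∀ᵐ x, Real.exp (v x) ≤ C) :
    haveI : IsFiniteMeasure (levyMeasure v) := isFiniteMeasure_levyMeasure hupp
    -- the Radon-Nikodym density defining the score exists for every `h` in `L²(ν)`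
    (∀ h : I → ℝ, MemLp h 2 (levyMeasure v) →
      scoreMeasure Δ (levyMeasure v) h ≪ᵥ (law Δ (levyMeasure v)).toENNRealVectorMeasure) ∧
    -- the score operator is a continuous linear map from `L²(ν)` into `L²₀(P_ν)`
    (∃ A : Lp ℝ 2 (levyMeasure v) →L[ℝ] L2Zero (law Δ (levyMeasure v)),
      ∀ h : Lp ℝ 2 (levyMeasure v),
        ((A h : Lp ℝ 2 (law Δ (levyMeasure v))) : I → ℝ)
          =ᵐ[law Δ (levyMeasure v)] score Δ (levyMeasure v) h) ∧
    -- the expansion of the log-likelihood ratio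
    (∀ h : I → ℝ, MemLp h ∞ (volume : Measure I) →
      law Δ (levyMeasure v) ≪ refLaw Δ ∧
      (∀ n : ℕ, law Δ (levyMeasure fun x => v x + h x / √(n : ℝ)) ≪ refLaw Δ) ∧
      ∀ (Ω : Type*) [MeasurableSpace Ω] (Q : Measure Ω) [IsProbabilityMeasure Q] (X : ℕ → Ω → I),
        (∀ i, HasLaw (X i) (law Δ (levyMeasure v)) Q) → iIndepFun X Q →
        (∀ n : ℕ, ∀ᵐ ω ∂Q,
          0 < likelihood Δ (levyMeasure v) n (fun i => X i ω) ∧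
          0 < likelihood Δ (levyMeasure fun x => v x + h x / √(n : ℝ)) n (fun i => X i ω)) ∧
        TendstoInMeasure Q
          (fun (n : ℕ) (ω : Ω) =>
            (logLikelihood Δ (levyMeasure fun x => v x + h x / √(n : ℝ)) n (fun i => X i ω)
                - logLikelihood Δ (levyMeasure v) n (fun i => X i ω))
              - (1 / √(n : ℝ) * ∑ i ∈ Finset.range n, score Δ (levyMeasure v) h (X i ω)
                  - 1 / 2 * ∫ x, score Δ (levyMeasure v) h x ^ 2 ∂(law Δ (levyMeasure v))))
          atTop (fun _ => 0)) := by
  have hfin : IsFiniteMeasure (levyMeasure v) := isFiniteMeasure_levyMeasure hupp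
  have hcν := smul_volume_le_levyMeasure hlow
  have hCν := levyMeasure_le_smul_volume hupp
  obtain ⟨K₀, hK₀⟩ := conv_le_smul_law hΔ hc hcν hCν
  have hac : (levyMeasure v).conv (law Δ (levyMeasure v)) ≪ law Δ (levyMeasure v) :=
    (Measure.absolutelyContinuous_of_le hK₀).trans Measure.smul_absolutelyContinuous
  refine ⟨fun h hh => scoreMeasure_absolutelyContinuous Δ hac (hh.integrable one_le_two),
    exists_score_operator Δ hK₀, fun h hh => ?_⟩
  -- Both the score and the perturbed Lévy measure depend only on the almost-everywhere class of h,
  -- so h may be replaced by an everywhere bounded Borel version.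
  obtain ⟨h', b, hh', hb, hhh'⟩ := exists_measurable_bounded_ae_eq hh
  have hscore : score Δ (levyMeasure v) h = score Δ (levyMeasure v) h' :=
    score_congr Δ ((withDensity_absolutelyContinuous _ _).ae_le hhh')
  simp_rw [levyMeasure_add_eq_tilt hv hh' hhh', hscore]
  set ν := levyMeasure v with hν
  have hfint : ∀ t, IsFiniteMeasure (tilt ν h' t) := fun t => isFiniteMeasure_tilt hb t
  have href : law Δ ν ≪ refLaw Δ := law_absolutelyContinuous_refLaw hΔ hCν
  have hreft : ∀ t, law Δ (tilt ν h' t) ≪ refLaw Δ := fun t => by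
    obtain ⟨C', hC'⟩ := tilt_le_volume hb hCν t
    exact law_absolutelyContinuous_refLaw hΔ hC'
  have htν : ∀ t, law Δ (tilt ν h' t) ≪ law Δ ν := fun t => by
    obtain ⟨C', hC'⟩ := tilt_le_volume hb hCν t
    exact law_absolutelyContinuous hΔ hc hcν hC'
  -- This direction uses that the tilted Lévy density stays bounded away from zero; it makes the
  -- perturbed likelihood positive under P_ν.
  have hνt : ∀ t, law Δ ν ≪ law Δ (tilt ν h' t) := fun t =>
    law_absolutelyContinuous hΔ (mul_pos (Real.exp_pos _) hc) (smul_volume_le_tilt hb hcν t) hCν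
  refine ⟨href, fun n => hreft _, fun Ω _ Q _ X hX hind => ?_⟩
  have hX' : ∀ {p : I → Prop}, (∀ᵐ x ∂(law Δ ν), p x) → ∀ᵐ ω ∂Q, ∀ i, p (X i ω) := fun hp =>
    ae_all_iff.2 fun i => by
      rw [← (hX i).map_eq] at hp
      exact ae_of_ae_map (hX i).aemeasurable hp
  have hpos := hX' (ae_density_pos (Measure.AbsolutelyContinuous.refl _) href)
  have hpost := fun t => hX' (ae_density_pos (hνt t) (hreft t))
  refine ⟨fun n => ?_, ?_⟩
  · filter_upwards [hpos, hpost (1 / √(n : ℝ))] with ω h1 h2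
    exact ⟨likelihood_pos h1, likelihood_pos h2⟩
  · obtain ⟨K, hK0, hK⟩ := exists_abs_rnDeriv_tilt_sub_le hΔ hh' hb hc hcν hCν
    obtain ⟨a, -, ha⟩ := ae_abs_score_le hΔ hh' hb hc hcν hCν
    have hi : Integrable h' ν :=
      Integrable.of_bound hh'.aestronglyMeasurable b (Eventually.of_forall hb)
    have hlan := tendstoInMeasure_log_expansion
      (R := fun t x => ((law Δ (tilt ν h' t)).rnDeriv (law Δ ν) x).toReal) hX hind
      (fun t => (Measure.measurable_rnDeriv _ _).ennreal_toReal) (measurable_score Δ ν h') hK0 ha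
      hK (fun t _ => by rw [Measure.integral_toReal_rnDeriv (htν t), probReal_univ])
      (integral_score Δ hac hi)
    refine hlan.congr' ?_ EventuallyEq.rfl
    -- For n > 0 the n copies of t²‖A‖²/2 add up to ‖A‖²/2, since n (1/√n)² = 1; this fails at n =
    -- 0.
    filter_upwards [eventually_gt_atTop 0] with n hn
    filter_upwards [hpos, hpost (1 / √(n : ℝ)), hX' (ae_density_eq_mul (htν (1 / √(n : ℝ))) href)]
      with ω h1 h2 h3
    rw [logLikelihood_sub_eq_sum
      (R := fun x => ((law Δ (tilt ν h' (1 / √(n : ℝ)))).rnDeriv (law Δ ν) x).toReal) h1 h2 h3,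
      Finset.sum_add_distrib, Finset.sum_sub_distrib, Finset.sum_const, Finset.card_range,
      nsmul_eq_mul, Finset.mul_sum, div_pow, Real.sq_sqrt (Nat.cast_nonneg n)]
    have hn' : (n : ℝ) ≠ 0 := by positivity
    field_simp
    ring
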